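/- **Model.** Fix integers $B\ge 1$, $\Delta^{\max}\ge 1$ and $p,\lambda\in[0,1]$. A sensor has a battery of capacity $B$. The system state in a slot $t=1,2,\dots$ is $s=(b,r,\Delta,\tilde b)$ with battery level $b\in\{0,\dots,B\}$, request indicator $r\in\{0,1\}$, age of information $\Delta\in\{1,\dots,\Delta^{\max}\}$ and last reported battery level $\tilde b\in\{1,\dots,B\}$. The controller observes $o=(r,\Delta,\tilde b)$ but not $b$, and chooses an action $a\in\{0,1\}$. Put $d=a\,\mathbf 1_{\{b\ge1\}}$. The cost of the slot is $\Delta^{\mathrm{OD}}=r\min\{(1-d)\Delta+1,\Delta^{\max}\}$, and the next state is $b'=\min\{b+e-d,B\}$; $(\Delta',\tilde b')=(1,b)$ if $d=1$ and $(\Delta',\tilde b')=(\min\{\Delta+1,\Delta^{\max}\},\tilde b)$ if $d=0$; and $r'$. Here $e$ and $r'$ are Bernoulli variables with parameters $\lambda$ and $p$, independent of each other and of the past. A belief is a probability vector $\beta=(\beta_0,\dots,\beta_B)$; a belief-state is $z=(\beta,r,\Delta,\tilde b)$. Starting from the initial belief-state $z_0=(\beta,o)$ means that the initial observation is $o$ and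 the initial battery level has law $\beta$; afterwards the belief in a slot is the conditional law of the battery level given all observations and actions so far. A policy on belief-states is a map $\pi$ from belief-states to $\{0,1\}$; more generally a history-dependent policy chooses each action as a function of all observations so far. The average cost is $\bar C_\pi(z_0)=\lim_{T\to\infty}\frac1T\sum_{t=1}^T\mathbb E_\pi[\Delta^{\mathrm{OD}}(t)\mid z_0]$. Let $\Lambda$ be the $(B+1)\times(B+1)$ matrix with $\Lambda_{jj}=1-\lambda$ and $\Lambda_{j+1,j}=\lambda$ for $0\le j<B$, $\Lambda_{BB}=1$, and all other entries $0$. For $1\le j\le B$ let $\rho^j$ be the vector with entries $1-\lambda$ at position $j-1$, $\lambda$ at position $j$, and $0$ elsewhere, and let $\rho^0=\rho^1$. A belief space is a set $\mathcal B$ of probability vectors on $\{0,\dots,B\}$ that contains $\rho^0,\dots,\rho^B$ and satisfies $\Lambda\mathcal B\subseteq\mathcal B$ (for example all probability vectors, or all $\Lambda^m\beta$ and $\Lambda^m\rho^j$ for a given initial belief $\beta$); then $\mathcal Z=\mathcal B\times\{0,1\}\times\{1,\dots,\Delta^{\max}\}\times\{1,\dots,B\}$. For a real function $h$ of the belief-state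 put $$Q(z,0)=r\min\{\Delta+1,\Delta^{\max}\}+\sum_{r'=0}^1[r'p+(1-r')(1-p)]\,h(\Lambda\beta,r',\min\{\Delta+1,\Delta^{\max}\},\tilde b),$$ $$Q(z,1)=r\beta_0\min\{\Delta+1,\Delta^{\max}\}+r(1-\beta_0)+\beta_0\sum_{r'=0}^1[r'p+(1-r')(1-p)]\,h(\rho^0,r',\min\{\Delta+1,\Delta^{\max}\},\tilde b)+\sum_{j=1}^B\beta_j\big[p\,h(\rho^j,1,1,j)+(1-p)\,h(\rho^j,0,1,j)\big].$$ **Theorem.** (i) If $\Delta^{\max}\ge2$, then for every function $h$, every belief-state $z$ and every $a\in\{0,1\}$, $Q(z,a)$ is the action-value of the belief-state MDP: $Q(z,a)=\mathbb E[\Delta^{\mathrm{OD}}\mid z,a]+\sum_{o'}\Pr(o'\mid z,a)\,h(z')$, where $z'$ consists of the next observation $o'$ and the belief obtained from $\beta$, $a$, $o'$ by Bayes' rule. (ii) There is a constant $\bar C^*$, independent of the initial belief-state and of the belief space, such that for every belief space $\mathcal B$ there is a function $h$, bounded on $\mathcal Z$, with $$\bar C^*+h(z)=\min_{a\in\{0,1\}}Q(z,a),\qquad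 z\in\mathcal Z.$$ (iii) Let $\mathcal B$ be a belief space, and let a constant $C$ and a function $h$, bounded on $\mathcal Z$, satisfy $C+h(z)=\min_aQ(z,a)$ for all $z\in\mathcal Z$. Then $C=\bar C^*$, and every policy $\pi^*$ with $\pi^*(z)\in\arg\min_{a}Q(z,a)$ for all $z\in\mathcal Z$ is optimal from every initial belief-state $z_0\in\mathcal Z$ with optimal average cost $\bar C^*$: the limit $\bar C_{\pi^*}(z_0)$ exists and equals $\bar C^*$, and for every history-dependent policy $g$ (in particular for every policy on belief-states), $\liminf_{T\to\infty}\frac1T\sum_{t=1}^T\mathbb E_g[\Delta^{\mathrm{OD}}(t)\mid z_0]\ge\bar C^*$. -/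

import Mathlib

open Filter Topology

namespace AoI

noncomputable section

/-! Throughout, `B` is the battery capacity, `D` the cap on the age of information,
`p` the request probability and `lam` the energy arrival probability. -/

/-- Observable part `(r, Δ, b̃)` of the state, with `r ∈ {0,1}`, `Δ ∈ {1,…,D}`, `b̃ ∈ {1,…,B}`. -/
abbrev Obs (B D : ℕ) : Type := Fin 2 × Set.Icc 1 D × Set.Icc 1 B

/-- System state `(b, r, Δ, b̃)`, with battery level `b ∈ {0,…,B}`. -/
abbrev State (B D : ℕ) : Type := Fin (B + 1) × Obs B D

/-- Commands of the edge node: `1` is "send an update", `0` is "do not send". -/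
abbrev Action : Type := Fin 2

/-- Vectors `(β_0,…,β_B)`. -/
abbrev Belief (B : ℕ) : Type := Fin (B + 1) → ℝ

/-- Belief-states `z = (β, r, Δ, b̃)`. -/
abbrev BeliefState (B D : ℕ) : Type := Belief B × Obs B D

/-- The AoI `min {Δ + 1, D}`. -/
def ageStep {D : ℕ} (x : Set.Icc 1 D) : Set.Icc 1 D :=
  ⟨min (x.1 + 1) D, by have := x.2.1; have := x.2.2; constructor <;> omega⟩

/-- The AoI `1`, available as soon as `{1,…,D}` is nonempty. -/
def ageOne {D : ℕ} (x : Set.Icc 1 D) : Set.Icc 1 D :=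
  ⟨1, le_rfl, x.2.1.trans x.2.2⟩

/-- A battery level `j ∈ {1,…,B}` as an element of `{0,…,B}`. -/
def level {B : ℕ} (j : Set.Icc 1 B) : Fin (B + 1) := ⟨j.1, Nat.lt_succ_of_le j.2.2⟩

/-! ### The partially observed system -/

/-- `Pr(r')`. -/
def requestProb (p : ℝ) (r' : Fin 2) : ℝ := if r' = 1 then p else 1 - p

/-- `Pr(b' | b, a)`. -/
def batteryProb {B : ℕ} (lam : ℝ) (b : Fin (B + 1)) (a : Action) (b' : Fin (B + 1)) : ℝ :=
  if a = 0 then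
    if b.1 = B then (if b'.1 = B then 1 else 0)
    else if b'.1 = b.1 + 1 then lam else if b'.1 = b.1 then 1 - lam else 0
  else
    if b.1 = 0 then (if b'.1 = 1 then lam else if b'.1 = 0 then 1 - lam else 0)
    else if b'.1 = b.1 then lam else if b'.1 + 1 = b.1 then 1 - lam else 0

/-- `Pr(Δ', b̃' | b, b̃, Δ, a)`: an update carrying the level `b` is received iff `a = 1` and
`b ≥ 1`. -/
def knowledgeProb {B D : ℕ} (b : Fin (B + 1)) (x : Set.Icc 1 D) (k : Set.Icc 1 B) (a : Action)
    (x' : Set.Icc 1 D) (k' : Set.Icc 1 B) : ℝ :=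
  if a = 1 ∧ 1 ≤ b.1 then (if x'.1 = 1 ∧ k'.1 = b.1 then 1 else 0)
  else (if x' = ageStep x ∧ k' = k then 1 else 0)

/-- The transition function `Pr(s' | s, a)`. -/
def transProb {B D : ℕ} (p lam : ℝ) (s : State B D) (a : Action) (s' : State B D) : ℝ :=
  requestProb p s'.2.1 * batteryProb lam s.1 a s'.1 *
    knowledgeProb s.1 s.2.2.1 s.2.2.2 a s'.2.2.1 s'.2.2.2

/-- On-demand AoI `r · min {(1 - d) Δ + 1, D}` with `d = a · 1{b ≥ 1}`. -/
def cost {B D : ℕ} (s : State B D) (a : Action) : ℝ :=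
  ((s.2.1 : ℕ) : ℝ) *
    min ((1 - (if a = 1 ∧ 1 ≤ s.1.1 then 1 else 0)) * ((s.2.2.1.1 : ℕ) : ℝ) + 1) (D : ℝ)

/-- State trajectories over the first `t + 1` slots. -/
abbrev Traj (B D t : ℕ) : Type := Fin (t + 1) → State B D

/-- The observations along a trajectory. -/
def observe {B D t : ℕ} (s : Traj B D t) : Fin (t + 1) → Obs B D := fun i => (s i).2

/-- History-dependent policies: the action in each slot is a function of all observations so far
(and hence of all earlier actions as well, these being functions of earlier observations). -/
abbrev Policy (B D : ℕ) : Type := ∀ t : ℕ, (Fin (t + 1) → Obs B D) → Action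

/-- The initial distribution over states given by a belief-state. -/
def initProb {B D : ℕ} (z₀ : BeliefState B D) (s : State B D) : ℝ :=
  if s.2 = z₀.2 then z₀.1 s.1 else 0

/-- The probability of a trajectory under a policy from the initial belief-state `z₀`. -/
def trajProb {B D : ℕ} (p lam : ℝ) (z₀ : BeliefState B D) (g : Policy B D) :
    ∀ t : ℕ, Traj B D t → ℝ
  | 0, s => initProb z₀ (s 0)
  | t + 1, s =>
      trajProb p lam z₀ g t (Fin.init s) *
        transProb p lam (Fin.init s (Fin.last t)) (g t (observe (Fin.init s))) (s (Fin.last (t + 1)))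

/-- The expected on-demand AoI in the `(t+1)`-st slot. -/
def expectedCost {B D : ℕ} (p lam : ℝ) (z₀ : BeliefState B D) (g : Policy B D) (t : ℕ) : ℝ :=
  ∑ s : Traj B D t, trajProb p lam z₀ g t s * cost (s (Fin.last t)) (g t (observe s))

/-- The average over the first `T` slots of the expected on-demand AoI. -/
def averageCost {B D : ℕ} (p lam : ℝ) (z₀ : BeliefState B D) (g : Policy B D) (T : ℕ) : ℝ :=
  (1 / (T : ℝ)) * ∑ t ∈ Finset.range T, expectedCost p lam z₀ g t

/-! ### Beliefs and policies that act on belief-states -/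

/-- The conditional law of the current battery level given the observed history `o`, when `μ` gives
the probabilities of the trajectories (histories of probability `0` get the value `0`). -/
def posterior {B D t : ℕ} (μ : Traj B D t → ℝ) (o : Fin (t + 1) → Obs B D) : Belief B :=
  fun j => (∑ s : Traj B D t, if observe s = o ∧ (s (Fin.last t)).1 = j then μ s else 0) /
    ∑ s : Traj B D t, if observe s = o then μ s else 0

/-- The probability of a trajectory when in every slot the action is `π z`, where `z` is the current
belief-state: the conditional law of the battery level given the history, and the current
observation. -/
def beliefTrajProb {B D : ℕ} (p lam : ℝ) (z₀ : BeliefState B D) (π : BeliefState B D → Action) :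
    ∀ t : ℕ, Traj B D t → ℝ
  | 0, s => initProb z₀ (s 0)
  | t + 1, s =>
      beliefTrajProb p lam z₀ π t (Fin.init s) *
        transProb p lam (Fin.init s (Fin.last t))
          (π (posterior (beliefTrajProb p lam z₀ π t) (observe (Fin.init s)),
            observe (Fin.init s) (Fin.last t)))
          (s (Fin.last (t + 1)))

/-- A policy `π : Z → A` on belief-states, run from `z₀`, as a history-dependent policy. -/
def beliefPolicy {B D : ℕ} (p lam : ℝ) (z₀ : BeliefState B D) (π : BeliefState B D → Action) :
    Policy B D :=
  fun t o => π (posterior (beliefTrajProb p lam z₀ π t) o, o (Fin.last t))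

/-- `beliefTrajProb` is the law of the trajectories under `beliefPolicy`, so the beliefs used by
`beliefPolicy` are the conditional laws of the battery level under that very policy. -/
theorem trajProb_beliefPolicy {B D : ℕ} (p lam : ℝ) (z₀ : BeliefState B D)
    (π : BeliefState B D → Action) (t : ℕ) :
    trajProb p lam z₀ (beliefPolicy p lam z₀ π) t = beliefTrajProb p lam z₀ π t := by
  induction t with
  | zero => rfl
  | succ t ih =>
    funext s
    simp only [trajProb, beliefTrajProb, ih]
    rfl

/-- The policy `π` on belief-states, run from `z₀`, has the long-run average cost `C`, as a limit,
and no history-dependent policy does better from `z₀`, not even along a subsequence. -/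
def IsOptimalFrom {B D : ℕ} (p lam : ℝ) (z₀ : BeliefState B D) (π : BeliefState B D → Action)
    (C : ℝ) : Prop :=
  Tendsto (averageCost p lam z₀ (beliefPolicy p lam z₀ π)) atTop (𝓝 C) ∧
    ∀ g : Policy B D, C ≤ liminf (averageCost p lam z₀ g) atTop

/-! ### The belief-state MDP -/

/-- `Pr(o' | z, a)`. -/
def obsProb {B D : ℕ} (p lam : ℝ) (z : BeliefState B D) (a : Action) (o' : Obs B D) : ℝ :=
  ∑ b : Fin (B + 1), z.1 b * ∑ b' : Fin (B + 1), transProb p lam (b, z.2) a (b', o')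

/-- Bayes' update of the belief after action `a` and next observation `o'`. -/
def bayesUpdate {B D : ℕ} (p lam : ℝ) (z : BeliefState B D) (a : Action) (o' : Obs B D) :
    Belief B :=
  fun j => (∑ b : Fin (B + 1), z.1 b * transProb p lam (b, z.2) a (j, o')) / obsProb p lam z a o'

/-- `c(z, a) + ∑_{o'} Pr(o' | z, a) h(z')`, where `z'` is the next belief-state. -/
def actionValue {B D : ℕ} (p lam : ℝ) (h : BeliefState B D → ℝ) (z : BeliefState B D)
    (a : Action) : ℝ :=
  (∑ b : Fin (B + 1), z.1 b * cost (b, z.2) a) +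
    ∑ o' : Obs B D, obsProb p lam z a o' * h (bayesUpdate p lam z a o', o')

/-- The banded matrix `Λ`: `1 - lam` on the diagonal except for a last entry `1`, and `lam` just
below the diagonal. -/
def Lam (B : ℕ) (lam : ℝ) : Matrix (Fin (B + 1)) (Fin (B + 1)) ℝ :=
  Matrix.of fun i j =>
    if i = j then (if j.1 = B then 1 else 1 - lam) else if i.1 = j.1 + 1 then lam else 0

/-- The vectors `ρ^j`: for `j ≥ 1` the entries `1 - lam` and `lam` stand at the positions `j - 1`
and `j`, and `ρ^0 = ρ^1`. -/
def rho (B : ℕ) (lam : ℝ) (j : ℕ) : Belief B :=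
  fun i => if i.1 + 1 = max j 1 then 1 - lam else if i.1 = max j 1 then lam else 0

/-- The explicit function `Q(z, a)` determined by a relative value function `h`. -/
def Q {B D : ℕ} (p lam : ℝ) (h : BeliefState B D → ℝ) : BeliefState B D → Action → ℝ
  | (β, r, x, k), a =>
    if a = 0 then
      ((r : ℕ) : ℝ) * min ((x.1 : ℝ) + 1) (D : ℝ) +
        ∑ r' : Fin 2, (((r' : ℕ) : ℝ) * p + (1 - ((r' : ℕ) : ℝ)) * (1 - p)) *
          h ((Lam B lam).mulVec β, r', ageStep x, k)
    else
      (((r : ℕ) : ℝ) * β 0 * min ((x.1 : ℝ) + 1) (D : ℝ) + ((r : ℕ) : ℝ) * (1 - β 0)) +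
        β 0 * ∑ r' : Fin 2, (((r' : ℕ) : ℝ) * p + (1 - ((r' : ℕ) : ℝ)) * (1 - p)) *
          h (rho B lam 0, r', ageStep x, k) +
        ∑ j : Set.Icc 1 B, β (level j) *
          (p * h (rho B lam j.1, 1, ageOne x, j) + (1 - p) * h (rho B lam j.1, 0, ageOne x, j))

/-- A belief space: a set of probability vectors on `{0,…,B}` that contains every `ρ^j` and is
closed under `Λ`. Examples are the set of all probability vectors and, for an initial belief `β`,
the countable set of all `Λ^m β` and `Λ^m ρ^j`. -/
def IsBeliefSpace {B : ℕ} (lam : ℝ) (S : Set (Belief B)) : Prop :=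
  S ⊆ stdSimplex ℝ (Fin (B + 1)) ∧ (∀ j ≤ B, rho B lam j ∈ S) ∧
    ∀ β ∈ S, (Lam B lam).mulVec β ∈ S

/-- `h` is bounded on the belief-states with belief in `S`. -/
def BoundedOn {B D : ℕ} (S : Set (Belief B)) (h : BeliefState B D → ℝ) : Prop :=
  ∃ K : ℝ, ∀ z : BeliefState B D, z.1 ∈ S → |h z| ≤ K

/-- The Bellman equation `C + h(z) = min_a Q(z, a)` on the belief-states with belief in `S`. -/
def SolvesBellman {B D : ℕ} (p lam : ℝ) (S : Set (Belief B)) (C : ℝ)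
    (h : BeliefState B D → ℝ) : Prop :=
  ∀ z : BeliefState B D, z.1 ∈ S → C + h z = min (Q p lam h z 0) (Q p lam h z 1)

end

end AoI

/-!
After averaging over the request indicator and dropping the last reported battery level, the dynamic
programming operator acts on functions of a belief and an age. It is monotone and commutes with
adding constants, so a uniform bound on the oscillation of its iterates `v n` from `0` makes these
grow like `n * C` up to a bounded error, and the lower limit of `v n - n * C` leads to a bounded
solution of `T u = C + u`.

For the oscillation bound, `v n` is monotone in the stochastic order of the battery level and in the
age, hence largest in the worst state (empty battery, saturated age). If `0 < lam`, then waiting `B`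
slots there and sending next finds a full battery with probability at least `lam ^ B`, so that the
excess over the state just after a full-battery update contracts by the factor `1 - lam ^ B`. If
`lam = 0`, then at most `B` updates can ever be sent and `v n` differs from `n * p * D` by a bounded
amount.

For `2 ≤ D`, an observation reveals whether an update arrived, so that Bayes' rule turns `Q` into
the action-value function, and the Bellman equation telescopes along every policy. For `D = 1` the
cost of every policy is the request indicator.
-/

namespace AoI

noncomputable section

/-! ### Additive eigenvectors of topical maps -/

/-- Sequences that are additive up to a defect of at most `K`; such a sequence grows linearly up to
an error of at most `K`. -/
def QuasiAdditive (G : ℕ → ℝ) (K : ℝ) : Prop := ∀ m n, |G (m + n) - G m - G n| ≤ K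

namespace QuasiAdditive

variable {G : ℕ → ℝ} {K : ℝ}

theorem subadditive_add_const (hG : QuasiAdditive G K) : Subadditive fun n => G n + K :=
  fun m n => by linarith [(abs_le.1 (hG m n)).2]

theorem neg (hG : QuasiAdditive G K) : QuasiAdditive (-G) K := fun m n => by
  simp only [Pi.neg_apply]
  rw [← abs_neg, show -(-G (m + n) - -G m - -G n) = G (m + n) - G m - G n by ring]
  exact hG m n

theorem abs_zero_le (hG : QuasiAdditive G K) : |G 0| ≤ K := by
  simpa using hG 0 0

theorem bddBelow_div (hG : QuasiAdditive G K) :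
    BddBelow (Set.range fun n : ℕ => (G n + K) / n) := by
  refine ⟨-|G 1 - K|, ?_⟩
  rintro _ ⟨n, rfl⟩
  rcases n.eq_zero_or_pos with rfl | hn
  · simp
  have hlow : -G n + K ≤ n * (-G 1 + K) + (-G 0 + K) := by
    simpa using hG.neg.subadditive_add_const.apply_mul_add_le n 1 0
  refine (neg_abs_le _).trans ((le_div_iff₀ (Nat.cast_pos.2 hn)).2 ?_)
  linarith [(abs_le.1 hG.abs_zero_le).1]

theorem exists_abs_sub_mul_le (hG : QuasiAdditive G K) : ∃ C : ℝ, ∀ n : ℕ, |G n - n * C| ≤ K := by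
  have hup := hG.subadditive_add_const
  have hlow := hG.neg.subadditive_add_const
  have hlim : hup.lim + hlow.lim = 0 := by
    have hsum := (hup.tendsto_lim hG.bddBelow_div).add (hlow.tendsto_lim hG.neg.bddBelow_div)
    refine tendsto_nhds_unique hsum
      ((tendsto_const_div_atTop_nhds_zero_nat (2 * K)).congr fun n => ?_)
    simp only [Pi.neg_apply]
    ring
  refine ⟨hup.lim, fun n => ?_⟩
  rcases eq_or_ne n 0 with rfl | hn
  · simpa using hG.abs_zero_le
  have hn_pos : (0 : ℝ) < n := by positivity
  have h₁ := (le_div_iff₀ hn_pos).1 (hup.lim_le_div hG.bddBelow_div hn)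
  have h₂ := (le_div_iff₀ hn_pos).1 (hlow.lim_le_div hG.neg.bddBelow_div hn)
  rw [eq_neg_of_add_eq_zero_right hlim, Pi.neg_apply] at h₂
  exact abs_le.2 ⟨by linarith, by linarith⟩

end QuasiAdditive

theorem tendsto_average_of_telescope {u E : ℕ → ℝ} {C K : ℝ} (hE : ∀ t, |E t| ≤ K)
    (hu : ∀ t, u t = C + E t - E (t + 1)) :
    Tendsto (fun T : ℕ => 1 / (T : ℝ) * ∑ t ∈ Finset.range T, u t) atTop (𝓝 C) := by
  have hsum (T : ℕ) : ∑ t ∈ Finset.range T, u t = T * C + (E 0 - E T) := by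
    simp_rw [hu, add_sub_assoc]
    rw [Finset.sum_add_distrib, Finset.sum_range_sub']
    simp
  have hzero : Tendsto (fun T : ℕ => (E 0 - E T) / (T : ℝ)) atTop (𝓝 0) := by
    refine squeeze_zero_norm (fun T => ?_) (tendsto_const_div_atTop_nhds_zero_nat (2 * K))
    rw [Real.norm_eq_abs, abs_div, Nat.abs_cast]
    gcongr
    linarith [abs_sub (E 0) (E T), hE 0, hE T]
  refine Tendsto.congr' ?_ (by simpa using hzero.const_add C)
  filter_upwards [eventually_ne_atTop 0] with T hT
  rw [hsum]
  field_simp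

theorem le_liminf_average_of_telescope {u E : ℕ → ℝ} {C K M : ℝ} (hE : ∀ t, |E t| ≤ K)
    (hu : ∀ t, C + E t - E (t + 1) ≤ u t) (hM : ∀ t, u t ≤ M) :
    C ≤ liminf (fun T : ℕ => 1 / (T : ℝ) * ∑ t ∈ Finset.range T, u t) atTop := by
  have haverage {v w : ℕ → ℝ} (hvw : ∀ t, v t ≤ w t) (T : ℕ) :
      1 / (T : ℝ) * ∑ t ∈ Finset.range T, v t ≤ 1 / (T : ℝ) * ∑ t ∈ Finset.range T, w t :=
    mul_le_mul_of_nonneg_left (Finset.sum_le_sum fun _ _ => hvw _) (by positivity)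
  have hlim := tendsto_average_of_telescope (C := C) hE fun _ => rfl
  have hbound : Tendsto (fun T : ℕ => 1 / (T : ℝ) * ∑ _t ∈ Finset.range T, M) atTop (𝓝 M) :=
    tendsto_average_of_telescope (E := 0) (K := 0) (by simp) (by simp)
  rw [← hlim.liminf_eq]
  exact liminf_le_liminf (Eventually.of_forall (haverage hu)) hlim.isBoundedUnder_ge
    (hbound.isBoundedUnder_le.mono_le (Eventually.of_forall (haverage hM))).isCoboundedUnder_ge

section Topical

variable {Z : Type*} {T : (Z → ℝ) → Z → ℝ}

/-- Topical maps: monotone maps on real functions that commute with the addition of constants.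
Dynamic programming operators are of this kind, and the average-cost optimality equation
`T h = C + h` asks for an additive eigenvector of such a map. -/
structure IsTopical (T : (Z → ℝ) → Z → ℝ) : Prop where
  monotone : Monotone T
  map_add_const : ∀ (f : Z → ℝ) (c : ℝ) (z : Z), T (fun y => f y + c) z = T f z + c

namespace IsTopical

theorem map_le_add_const (hT : IsTopical T) {f g : Z → ℝ} {c : ℝ} (hfg : ∀ z, f z ≤ g z + c)
    (z : Z) : T f z ≤ T g z + c :=
  (hT.monotone hfg z).trans_eq (hT.map_add_const g c z)

theorem iterate_le_add_const (hT : IsTopical T) {f g : Z → ℝ} {c : ℝ}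
    (hfg : ∀ z, f z ≤ g z + c) (n : ℕ) (z : Z) : T^[n] f z ≤ T^[n] g z + c := by
  induction n generalizing f g with
  | zero => exact hfg z
  | succ _ ih => exact ih (hT.map_le_add_const hfg)

theorem sub_const (hT : IsTopical T) (C : ℝ) : IsTopical fun f z => T f z - C where
  monotone _ _ hfg z := sub_le_sub_right (hT.monotone hfg z) C
  map_add_const f c z := by rw [hT.map_add_const, add_sub_right_comm]

theorem iterate_sub_const (hT : IsTopical T) (C : ℝ) (f : Z → ℝ) (n : ℕ) :
    (fun f z => T f z - C)^[n] f = fun z => T^[n] f z + -(n * C) := by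
  induction n with
  | zero => simp
  | succ n ih =>
    rw [Function.iterate_succ_apply', Function.iterate_succ_apply', ih]
    funext z
    rw [hT.map_add_const]
    push_cast
    ring

end IsTopical

theorem exists_map_le_self_of_bounded_orbit (hmono : Monotone T) (hcont : Continuous T)
    {f : Z → ℝ} {L : ℝ} (hL : ∀ n z, |T^[n] f z| ≤ L) :
    ∃ g : Z → ℝ, (∀ z, |g z| ≤ L) ∧ T g ≤ g := by
  have hbelow (n : ℕ) (z : Z) : BddBelow (Set.range fun k => T^[n + k] f z) :=
    ⟨-L, Set.forall_mem_range.2 fun k => (abs_le.1 (hL _ z)).1⟩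
  -- `g` is the pointwise lower limit of the orbit.
  set a : ℕ → Z → ℝ := fun n z => ⨅ k, T^[n + k] f z
  have ha_le (n k : ℕ) (z : Z) : a n z ≤ T^[n + k] f z := ciInf_le (hbelow n z) k
  have ha_abs (n : ℕ) (z : Z) : |a n z| ≤ L :=
    abs_le.2 ⟨le_ciInf fun k => (abs_le.1 (hL _ z)).1, (ha_le n 0 z).trans (abs_le.1 (hL _ z)).2⟩
  have ha_mono (z : Z) : Monotone fun n => a n z := monotone_nat_of_le_succ fun n =>
    le_ciInf fun k => (ha_le n (1 + k) z).trans_eq (by rw [add_assoc])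
  have ha_above (z : Z) : BddAbove (Set.range fun n => a n z) :=
    ⟨L, Set.forall_mem_range.2 fun n => (abs_le.1 (ha_abs n z)).2⟩
  have hTa (n : ℕ) (z : Z) : T (a n) z ≤ a (n + 1) z := le_ciInf fun k => by
    rw [add_right_comm, Function.iterate_succ_apply']
    exact hmono (ha_le n k) z
  refine ⟨fun z => ⨆ n, a n z, fun z => abs_le.2 ⟨?_, ciSup_le fun n => (abs_le.1 (ha_abs n z)).2⟩,
    fun z => ?_⟩
  · exact (abs_le.1 (ha_abs 0 z)).1.trans (le_ciSup (ha_above z) 0)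
  · have hlim : Tendsto a atTop (𝓝 fun z => ⨆ n, a n z) :=
      tendsto_pi_nhds.2 fun z => tendsto_atTop_ciSup (ha_mono z) (ha_above z)
    refine le_of_tendsto' (((hcont.tendsto _).comp hlim).apply_nhds z) fun n => ?_
    exact (hTa n z).trans (le_ciSup (ha_above z) (n + 1))

theorem exists_isFixedPt_of_map_le_self (hmono : Monotone T) (hcont : Continuous T)
    {g : Z → ℝ} {L : ℝ} (hg : T g ≤ g) (hL : ∀ n z, |T^[n] g z| ≤ L) :
    ∃ h : Z → ℝ, (∀ z, |h z| ≤ L) ∧ T h = h := by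
  have hlim : Tendsto (fun n => T^[n] g) atTop (𝓝 fun z => ⨅ n, T^[n] g z) :=
    tendsto_pi_nhds.2 fun z => tendsto_atTop_ciInf
      (fun _ _ hmn => hmono.antitone_iterate_of_map_le hg hmn z)
      ⟨-L, Set.forall_mem_range.2 fun n => (abs_le.1 (hL n z)).1⟩
  exact ⟨_, fun z => le_of_tendsto' (tendsto_pi_nhds.1 hlim z).abs fun n => hL n z,
    isFixedPt_of_tendsto_iterate hlim hcont.continuousAt⟩

theorem IsTopical.exists_isFixedPt_of_bounded_orbit (hT : IsTopical T) (hcont : Continuous T)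
    {f : Z → ℝ} {L : ℝ} (hL : ∀ n z, |T^[n] f z| ≤ L) :
    ∃ h : Z → ℝ, (∃ M, ∀ z, |h z| ≤ M) ∧ T h = h := by
  obtain ⟨g, hg_abs, hg⟩ := exists_map_le_self_of_bounded_orbit hT.monotone hcont hL
  have hdist (z : Z) : |g z - f z| ≤ 2 * L := by
    have hf : |f z| ≤ L := hL 0 z
    linarith [abs_sub (g z) (f z), hg_abs z]
  have horbit (n : ℕ) (z : Z) : |T^[n] g z| ≤ 3 * L := by
    have h₁ := hT.iterate_le_add_const (f := f) (g := g) (c := 2 * L)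
      (fun z => by linarith [(abs_le.1 (hdist z)).1]) n z
    have h₂ := hT.iterate_le_add_const (f := g) (g := f) (c := 2 * L)
      (fun z => by linarith [(abs_le.1 (hdist z)).2]) n z
    have h₃ := abs_le.1 (hL n z)
    exact abs_le.2 ⟨by linarith, by linarith⟩
  obtain ⟨h, hh_abs, hh⟩ := exists_isFixedPt_of_map_le_self hT.monotone hcont hg horbit
  exact ⟨h, ⟨_, hh_abs⟩, hh⟩

theorem IsTopical.quasiAdditive_of_abs_iterate_sub_le [Nonempty Z] (hT : IsTopical T) {G : ℕ → ℝ}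
    {K : ℝ} (hK : ∀ n z, |T^[n] 0 z - G n| ≤ K) : QuasiAdditive G (3 * K) := by
  intro m n
  obtain ⟨z⟩ := ‹Nonempty Z›
  have hm (y : Z) := abs_le.1 (hK m y)
  have hupper := hT.iterate_le_add_const (f := T^[m] 0) (g := 0) (c := G m + K)
    (fun y => by simp only [Pi.zero_apply]; linarith [(hm y).2]) n z
  have hlower := hT.iterate_le_add_const (f := 0) (g := T^[m] 0) (c := K - G m)
    (fun y => by simp only [Pi.zero_apply]; linarith [(hm y).1]) n z
  rw [← Function.iterate_add_apply, add_comm n m] at hupper hlower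
  have hmn := abs_le.1 (hK (m + n) z)
  have hn := abs_le.1 (hK n z)
  exact abs_le.2 ⟨by linarith, by linarith⟩

theorem IsTopical.exists_additive_eigenvector [Nonempty Z] (hT : IsTopical T)
    (hcont : Continuous T) {G : ℕ → ℝ} {K : ℝ} (hK : ∀ n z, |T^[n] 0 z - G n| ≤ K) :
    ∃ (C : ℝ) (h : Z → ℝ), (∃ M, ∀ z, |h z| ≤ M) ∧ ∀ z, T h z = C + h z := by
  obtain ⟨C, hC⟩ := (hT.quasiAdditive_of_abs_iterate_sub_le hK).exists_abs_sub_mul_le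
  have horbit (n : ℕ) (z : Z) : |(fun f z => T f z - C)^[n] 0 z| ≤ 4 * K := by
    rw [hT.iterate_sub_const]
    have hn := abs_le.1 (hK n z)
    have hCn := abs_le.1 (hC n)
    exact abs_le.2 ⟨by linarith, by linarith⟩
  have hcont' : Continuous fun (f : Z → ℝ) z => T f z - C := by fun_prop
  obtain ⟨h, hh_abs, hh⟩ := (hT.sub_const C).exists_isFixedPt_of_bounded_orbit hcont' horbit
  exact ⟨C, h, hh_abs, fun z => by linarith [congrFun hh z]⟩

end Topical

/-! ### Laws of the battery level -/

section Simplex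

variable {ι : Type*} [Fintype ι] {β : ι → ℝ}

theorem dotProduct_const_of_mem_stdSimplex (hβ : β ∈ stdSimplex ℝ ι) (c : ℝ) :
    (β ⬝ᵥ fun _ => c) = c := by
  simp only [dotProduct, ← Finset.sum_mul, hβ.2, one_mul]

theorem dotProduct_le_of_mem_stdSimplex (hβ : β ∈ stdSimplex ℝ ι) {f : ι → ℝ} {c : ℝ}
    (hf : ∀ i, f i ≤ c) : β ⬝ᵥ f ≤ c :=
  (dotProduct_le_dotProduct_of_nonneg_left hf hβ.1).trans_eq
    (dotProduct_const_of_mem_stdSimplex hβ c)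

theorem le_dotProduct_of_mem_stdSimplex (hβ : β ∈ stdSimplex ℝ ι) {f : ι → ℝ} {c : ℝ}
    (hf : ∀ i, c ≤ f i) : c ≤ β ⬝ᵥ f :=
  (dotProduct_const_of_mem_stdSimplex hβ c).symm.trans_le
    (dotProduct_le_dotProduct_of_nonneg_left hf hβ.1)

theorem dotProduct_le_dotProduct_of_ne_zero {w f f' : ι → ℝ} (hw : 0 ≤ w)
    (h : ∀ i, w i ≠ 0 → f i ≤ f' i) : w ⬝ᵥ f ≤ w ⬝ᵥ f' := Finset.sum_le_sum fun i _ => by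
  rcases eq_or_ne (w i) 0 with hi | hi
  · rw [hi, zero_mul, zero_mul]
  · exact mul_le_mul_of_nonneg_left (h i hi) (hw i)

theorem mulVec_mem_stdSimplex [DecidableEq ι] {M : Matrix ι ι ℝ}
    (hM : M ∈ Matrix.colStochastic ℝ ι) (hβ : β ∈ stdSimplex ℝ ι) :
    M.mulVec β ∈ stdSimplex ℝ ι :=
  ⟨Matrix.nonneg_mulVec_of_mem_colStochastic hM hβ.1,
    (Matrix.sum_mulVec_of_mem_colStochastic hM).trans hβ.2⟩

end Simplex

section Request

variable {p : ℝ} {φ ψ : Fin 2 → ℝ}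

/-- The mean of a function of the request indicator of the next slot. -/
def requestMean (p : ℝ) (φ : Fin 2 → ℝ) : ℝ := p * φ 1 + (1 - p) * φ 0

theorem requestMean_add_mul (p c d : ℝ) : requestMean p (fun r => c + (r : ℕ) * d) = c + p * d := by
  simp only [requestMean, Fin.val_one, Fin.val_zero, Nat.cast_one, Nat.cast_zero]
  ring

theorem requestMean_const (p c : ℝ) : requestMean p (fun _ => c) = c := by
  simp only [requestMean]
  ring

theorem requestMean_add_const (p : ℝ) (φ : Fin 2 → ℝ) (c : ℝ) :
    requestMean p (fun r => φ r + c) = requestMean p φ + c := by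
  simp only [requestMean]
  ring

theorem requestMean_mono (hp : p ∈ unitInterval) (h : ∀ r, φ r ≤ ψ r) :
    requestMean p φ ≤ requestMean p ψ :=
  add_le_add (mul_le_mul_of_nonneg_left (h 1) hp.1)
    (mul_le_mul_of_nonneg_left (h 0) (sub_nonneg.2 hp.2))

theorem request_le_one (r : Fin 2) : ((r : ℕ) : ℝ) ≤ 1 := by
  exact_mod_cast Nat.le_of_lt_succ r.2

end Request

section Levels

variable {B : ℕ}

/-- The largest element of `{1,…,n}`: a full battery, or the age cap. -/
def iccMax (n : ℕ) [NeZero n] : Set.Icc 1 n := ⟨n, NeZero.one_le, le_rfl⟩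

theorem level_ne_zero (j : Set.Icc 1 B) : level j ≠ 0 := fun h => by
  have hj : j.1 = 0 := congrArg Fin.val h
  have := j.2.1
  omega

theorem exists_level_eq {b : Fin (B + 1)} (hb : b ≠ 0) : ∃ j, level j = b :=
  ⟨⟨b.1, Fin.pos_of_ne_zero hb, b.is_le⟩, rfl⟩

theorem sum_eq_zero_add_sum_level {M : Type*} [AddCommMonoid M] (f : Fin (B + 1) → M) :
    ∑ b, f b = f 0 + ∑ j : Set.Icc 1 B, f (level j) := by
  rw [Fin.sum_univ_succ]
  congr 1
  let e : Fin B ≃ Set.Icc 1 B :=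
    { toFun := fun i => ⟨i.1 + 1, Nat.succ_le_succ (Nat.zero_le _), i.2⟩
      invFun := fun j => ⟨j.1 - 1, by have := j.2.1; have := j.2.2; omega⟩
      left_inv := fun i => Fin.ext rfl
      right_inv := fun j => Subtype.ext (Nat.sub_add_cancel j.2.1) }
  exact Fintype.sum_equiv e _ _ fun _ => rfl

end Levels

section Battery

variable {B : ℕ} {lam : ℝ}

/-- The battery level after an energy arrival. -/
def levelUp (b : Fin (B + 1)) : Fin (B + 1) := ⟨min (b.1 + 1) B, by omega⟩

/-- The battery level after an attempted update, before a possible energy arrival. -/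
def levelDown (b : Fin (B + 1)) : Fin (B + 1) := ⟨b.1 - 1, by omega⟩

theorem levelUp_mono : Monotone (levelUp (B := B)) := fun i j hij => by
  have : i.1 ≤ j.1 := hij
  simp only [levelUp, Fin.mk_le_mk]
  omega

theorem levelDown_mono : Monotone (levelDown (B := B)) := fun i j hij => by
  have : i.1 ≤ j.1 := hij
  simp only [levelDown, Fin.mk_le_mk]
  omega

theorem Lam_col_eq (j : Fin (B + 1)) :
    (Lam B lam).col j = (1 - lam) • Pi.single j 1 + lam • Pi.single (levelUp j) 1 := by
  funext i
  have hi := i.2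
  simp only [Matrix.col_apply, Lam, Matrix.of_apply, levelUp, Pi.add_apply, Pi.smul_apply,
    Pi.single_apply, Fin.ext_iff, smul_eq_mul]
  split_ifs <;> first | omega | ring

theorem rho_eq_Lam_col [NeZero B] (j : Fin (B + 1)) :
    rho B lam j.1 = (Lam B lam).col (levelDown j) := by
  funext i
  have hB := NeZero.one_le (n := B)
  have hi := i.2
  simp only [rho, Matrix.col_apply, Lam, Matrix.of_apply, levelDown, Fin.ext_iff]
  split_ifs <;> first | rfl | omega

theorem batteryProb_zero (b b' : Fin (B + 1)) : batteryProb lam b 0 b' = Lam B lam b' b := by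
  have hb' := b'.2
  simp only [batteryProb, Lam, Matrix.of_apply, Fin.ext_iff, if_true]
  split_ifs <;> first | rfl | omega

theorem batteryProb_one (b b' : Fin (B + 1)) : batteryProb lam b 1 b' = rho B lam b.1 b' := by
  simp only [batteryProb, rho, one_ne_zero, if_false]
  split_ifs <;> first | rfl | omega

theorem vecMul_Lam (f : Fin (B + 1) → ℝ) (j : Fin (B + 1)) :
    Matrix.vecMul f (Lam B lam) j = (1 - lam) * f j + lam * f (levelUp j) := by
  change f ⬝ᵥ (Lam B lam).col j = _
  simp only [Lam_col_eq, dotProduct_add, dotProduct_smul, dotProduct_single_one, smul_eq_mul]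

theorem mulVec_Lam_dotProduct (β f : Fin (B + 1) → ℝ) :
    (Lam B lam).mulVec β ⬝ᵥ f = β ⬝ᵥ fun j => (1 - lam) * f j + lam * f (levelUp j) := by
  rw [dotProduct_comm, Matrix.dotProduct_mulVec, dotProduct_comm]
  simp only [dotProduct, vecMul_Lam]

theorem Lam_mem_colStochastic (hlam : lam ∈ unitInterval) :
    Lam B lam ∈ Matrix.colStochastic ℝ (Fin (B + 1)) := by
  refine ⟨fun i j => ?_, ?_⟩
  · have h₀ := hlam.1
    have h₁ := hlam.2
    simp only [Lam, Matrix.of_apply]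
    split_ifs <;> linarith
  · funext j
    rw [vecMul_Lam]
    simp

theorem Lam_zero : Lam B 0 = 1 := by
  ext i j
  simp only [Lam, Matrix.of_apply, Matrix.one_apply]
  split_ifs <;> simp

end Battery

section StochasticOrder

variable {B : ℕ} {lam : ℝ}

/-- The usual stochastic order on laws of the battery level, tested against decreasing functions:
`γ` tends to have the fuller battery. -/
def StochasticLE (β γ : Belief B) : Prop := ∀ f : Fin (B + 1) → ℝ, Antitone f → γ ⬝ᵥ f ≤ β ⬝ᵥ f

namespace StochasticLE

theorem refl (β : Belief B) : StochasticLE β β := fun _ _ => le_rfl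

theorem mulVec_Lam (hlam : lam ∈ unitInterval) {β γ : Belief B} (h : StochasticLE β γ) :
    StochasticLE ((Lam B lam).mulVec β) ((Lam B lam).mulVec γ) := fun f hf => by
  rw [mulVec_Lam_dotProduct, mulVec_Lam_dotProduct]
  refine h _ fun i j hij => ?_
  exact add_le_add (mul_le_mul_of_nonneg_left (hf hij) (sub_nonneg.2 hlam.2))
    (mul_le_mul_of_nonneg_left (hf (levelUp_mono hij)) hlam.1)

theorem single_mono {i j : Fin (B + 1)} (hij : i ≤ j) :
    StochasticLE (Pi.single i 1) (Pi.single j 1) := fun f hf => by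
  simpa only [single_one_dotProduct] using hf hij

theorem single_zero_le {β : Belief B} (hβ : β ∈ stdSimplex ℝ (Fin (B + 1))) :
    StochasticLE (Pi.single 0 1) β := fun f hf => by
  rw [single_one_dotProduct]
  exact dotProduct_le_of_mem_stdSimplex hβ fun i => hf (Fin.zero_le i)

theorem le_single_last {β : Belief B} (hβ : β ∈ stdSimplex ℝ (Fin (B + 1))) :
    StochasticLE β (Pi.single (Fin.last B) 1) := fun f hf => by
  rw [single_one_dotProduct]
  exact le_dotProduct_of_mem_stdSimplex hβ fun i => hf (Fin.le_last i)

end StochasticLE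

end StochasticOrder

/-! ### The reduced problem -/

section Age

variable {B D : ℕ} (x y : Set.Icc 1 D)

theorem ageStep_mono : Monotone (ageStep (D := D)) := fun _ _ hxy =>
  Subtype.mk_le_mk.2 (min_le_min_right D (Nat.succ_le_succ hxy))

theorem ageOne_le : ageOne x ≤ y := y.2.1

theorem ageStep_iccMax [NeZero D] : ageStep (iccMax D) = iccMax D :=
  Subtype.ext (min_eq_right (Nat.le_succ D))

/-- The age after an attempted update, when the battery level is `b`. -/
def attemptAge (x : Set.Icc 1 D) (b : Fin (B + 1)) : Set.Icc 1 D :=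
  if b = 0 then ageStep x else ageOne x

theorem attemptAge_zero : attemptAge x (0 : Fin (B + 1)) = ageStep x := if_pos rfl

theorem attemptAge_of_ne_zero {b : Fin (B + 1)} (hb : b ≠ 0) : attemptAge x b = ageOne x :=
  if_neg hb

theorem attemptAge_mono (b : Fin (B + 1)) : Monotone fun x : Set.Icc 1 D => attemptAge x b := by
  intro x y hxy
  rcases eq_or_ne b 0 with rfl | hb
  · simpa only [attemptAge_zero] using ageStep_mono hxy
  · simpa only [attemptAge_of_ne_zero _ hb] using ageOne_le _ _

theorem antitone_attemptAge : Antitone (attemptAge (B := B) x) := fun i j hij => by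
  rcases eq_or_ne j 0 with rfl | hj
  · rw [le_antisymm hij (Fin.zero_le _)]
  · rw [attemptAge_of_ne_zero x hj]
    exact ageOne_le _ _

/-- A bound on what is saved, compared with a permanently saturated age, while the age grows from
`x` to saturation. -/
def saturationCost (x : Set.Icc 1 D) : ℝ := D * (D + 1 - x.1)

theorem le_saturationCost : (D : ℝ) ≤ saturationCost x := by
  have hx : (x.1 : ℝ) ≤ D := by exact_mod_cast x.2.2
  exact le_mul_of_one_le_right (Nat.cast_nonneg D) (by linarith)

theorem saturationCost_le : saturationCost x ≤ D * D := by
  have hx : (1 : ℝ) ≤ x.1 := by exact_mod_cast x.2.1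
  exact mul_le_mul_of_nonneg_left (by linarith) (Nat.cast_nonneg D)

theorem request_mul_le (r : Fin 2) : ((r : ℕ) : ℝ) * D ≤ D :=
  mul_le_of_le_one_left (Nat.cast_nonneg D) (request_le_one r)

theorem request_mul_age_le (r : Fin 2) : ((r : ℕ) : ℝ) * x.1 ≤ (r : ℕ) * D :=
  mul_le_mul_of_nonneg_left (by exact_mod_cast x.2.2) (Nat.cast_nonneg _)

theorem request_mul_age_mono (r : Fin 2) {x y : Set.Icc 1 D} (hxy : x ≤ y) :
    ((r : ℕ) : ℝ) * x.1 ≤ (r : ℕ) * y.1 :=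
  mul_le_mul_of_nonneg_left (by exact_mod_cast hxy) (Nat.cast_nonneg _)

theorem saturationCost_ageStep_add_le (r : Fin 2) :
    saturationCost (ageStep x) + (r : ℕ) * D ≤ (r : ℕ) * (ageStep x).1 + saturationCost x := by
  rcases lt_or_eq_of_le x.2.2 with hx | hx
  · have hstep : ((ageStep x).1 : ℝ) = x.1 + 1 := by
      exact_mod_cast min_eq_left hx
    have hpos : (0 : ℝ) ≤ (r : ℕ) * (x.1 + 1) := by positivity
    simp only [saturationCost, hstep]
    linarith [request_mul_le (D := D) r]
  · have hstep : ageStep x = x := Subtype.ext ((min_eq_right (by omega)).trans hx.symm)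
    rw [hstep, hx, add_comm]

end Age

/-- Laws of the battery level. -/
abbrev Law (B : ℕ) : Type := stdSimplex ℝ (Fin (B + 1))

section ReducedProblem

variable {B D : ℕ} (p lam : unitInterval) (u : Law B × Set.Icc 1 D → ℝ) (r : Fin 2)

/-- The belief after a slot in which no update was attempted. -/
def waitBelief (β : Law B) : Law B :=
  ⟨(Lam B lam).mulVec β.1, mulVec_mem_stdSimplex (Lam_mem_colStochastic lam.2) β.2⟩

/-- The belief after an update was attempted at battery level `b`. -/
def sentBelief (b : Fin (B + 1)) : Law B := waitBelief lam (stdSimplex.vertex (levelDown b))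

/-- The value of waiting when the cost-to-go is `u`, in the reduced problem. This problem is
obtained by averaging over the request indicator and dropping the last reported battery level, which
influences neither costs nor beliefs. -/
def waitValue (y : Law B × Set.Icc 1 D) : ℝ :=
  (r : ℕ) * (ageStep y.2).1 + u (waitBelief lam y.1, ageStep y.2)

/-- The value of attempting an update at age `x`, as a function of the battery level. -/
def sendOutcome (x : Set.Icc 1 D) (b : Fin (B + 1)) : ℝ :=
  (r : ℕ) * (attemptAge x b).1 + u (sentBelief lam b, attemptAge x b)

/-- The value of attempting an update. -/
def sendValue (y : Law B × Set.Icc 1 D) : ℝ := y.1.1 ⬝ᵥ sendOutcome lam u r y.2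

/-- The value of the better action in a slot with request indicator `r`. -/
def stageValue (y : Law B × Set.Icc 1 D) : ℝ := min (waitValue lam u r y) (sendValue lam u r y)

/-- The dynamic programming operator of the reduced problem. -/
def bellman (y : Law B × Set.Icc 1 D) : ℝ := requestMean p fun r => stageValue lam u r y

/-- The optimal cost of the reduced problem over `n` slots. -/
def value (n : ℕ) : Law B × Set.Icc 1 D → ℝ := (bellman p lam)^[n] 0

variable {u} in
theorem stageValue_mono {u' : Law B × Set.Icc 1 D → ℝ} (h : u ≤ u') :
    stageValue lam u r ≤ stageValue lam u' r := fun y =>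
  min_le_min (add_le_add_right (h _) _) (dotProduct_le_dotProduct_of_nonneg_left
    (fun _ => add_le_add_right (h _) _) y.1.2.1)

theorem stageValue_add_const (c : ℝ) (y : Law B × Set.Icc 1 D) :
    stageValue lam (fun z => u z + c) r y = stageValue lam u r y + c := by
  have hsend : sendValue lam (fun z => u z + c) r y = sendValue lam u r y + c := by
    have hout : sendOutcome lam (fun z => u z + c) r y.2 =
        sendOutcome lam u r y.2 + fun _ => c := funext fun _ => (add_assoc _ _ _).symm
    rw [sendValue, hout, dotProduct_add, dotProduct_const_of_mem_stdSimplex y.1.2, sendValue]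
  rw [stageValue, stageValue, hsend, ← min_add_add_right, waitValue, waitValue, add_assoc]

theorem stageValue_le_wait (y : Law B × Set.Icc 1 D) :
    stageValue lam u r y ≤ u (waitBelief lam y.1, ageStep y.2) + (r : ℕ) * D := by
  refine (min_le_left _ _).trans ?_
  rw [waitValue, add_comm]
  exact add_le_add_right (request_mul_age_le _ r) _

variable {u} in
theorem stageValue_nonneg (hu : 0 ≤ u) : 0 ≤ stageValue lam u r := fun y =>
  le_min (add_nonneg (by positivity) (hu _))
    (le_dotProduct_of_mem_stdSimplex y.1.2 fun _ => add_nonneg (by positivity) (hu _))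

theorem isTopical_bellman : IsTopical (bellman (B := B) (D := D) p lam) where
  monotone _ _ h y := requestMean_mono p.2 fun r => stageValue_mono lam r h y
  map_add_const u c y := by simp only [bellman, stageValue_add_const, requestMean_add_const]

theorem continuous_bellman : Continuous (bellman (B := B) (D := D) p lam) := by
  refine continuous_pi fun y => ?_
  simp only [bellman, requestMean, stageValue, waitValue, sendValue, sendOutcome, dotProduct]
  fun_prop

section Bounds

variable {p lam u} {y : Law B × Set.Icc 1 D} {c d : ℝ}

theorem le_bellman (hwait : ∀ r : Fin 2, c + (r : ℕ) * d ≤ waitValue lam u r y)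
    (hsend : ∀ r : Fin 2, c + (r : ℕ) * d ≤ sendValue lam u r y) : c + p * d ≤ bellman p lam u y :=
  (requestMean_add_mul p c d).symm.trans_le
    (requestMean_mono p.2 fun r => le_min (hwait r) (hsend r))

theorem bellman_le_wait (p lam : unitInterval) (u : Law B × Set.Icc 1 D → ℝ)
    (y : Law B × Set.Icc 1 D) :
    bellman p lam u y ≤ u (waitBelief lam y.1, ageStep y.2) + p * D := by
  rw [← requestMean_add_mul]
  exact requestMean_mono p.2 fun r => stageValue_le_wait lam u r y

theorem bellman_le_of_sendValue_le (hsend : ∀ r, sendValue lam u r y ≤ c) :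
    bellman p lam u y ≤ c :=
  (requestMean_mono p.2 fun r => (min_le_right _ _).trans (hsend r)).trans_eq
    (requestMean_const p c)

theorem bellman_nonneg (hu : 0 ≤ u) : 0 ≤ bellman p lam u := fun y =>
  (requestMean_const p 0).symm.trans_le
    (requestMean_mono p.2 fun r => stageValue_nonneg lam r hu y)

end Bounds

theorem value_zero : value (B := B) (D := D) p lam 0 = 0 := rfl

theorem value_succ (n : ℕ) :
    value (B := B) (D := D) p lam (n + 1) = bellman p lam (value p lam n) :=
  Function.iterate_succ_apply' _ _ _

theorem value_monotone : Monotone (value (B := B) (D := D) p lam) :=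
  (isTopical_bellman p lam).monotone.monotone_iterate_of_le_map (bellman_nonneg le_rfl)

theorem value_succ_le (n : ℕ) (y : Law B × Set.Icc 1 D) :
    value p lam (n + 1) y ≤ value p lam n y + p * D :=
  (isTopical_bellman p lam).iterate_le_add_const (fun y => bellman_le_wait p lam 0 y) n y

theorem value_le_mul (n : ℕ) (y : Law B × Set.Icc 1 D) : value p lam n y ≤ n * (p * D) := by
  induction n with
  | zero => simp [value_zero]
  | succ n ih =>
    push_cast
    linarith [value_succ_le p lam n y]

end ReducedProblem

section CostMonotone

variable {B D : ℕ} {lam : unitInterval} {u : Law B × Set.Icc 1 D → ℝ}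

/-- The cost-to-go increases as the battery gets emptier and the information older. -/
def CostMonotone (u : Law B × Set.Icc 1 D → ℝ) : Prop :=
  ∀ ⦃β γ : Law B⦄, StochasticLE β.1 γ.1 → ∀ ⦃x y : Set.Icc 1 D⦄, x ≤ y → u (γ, x) ≤ u (β, y)

theorem stochasticLE_sentBelief {i j : Fin (B + 1)} (hij : i ≤ j) :
    StochasticLE (sentBelief lam i).1 (sentBelief lam j).1 :=
  (StochasticLE.single_mono (levelDown_mono hij)).mulVec_Lam lam.2

namespace CostMonotone

theorem waitValue (hu : CostMonotone u) (r : Fin 2) : CostMonotone (waitValue lam u r) :=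
  fun _ _ hβγ _ _ hxy => add_le_add (request_mul_age_mono r (ageStep_mono hxy))
    (hu (hβγ.mulVec_Lam lam.2) (ageStep_mono hxy))

theorem antitone_sendOutcome (hu : CostMonotone u) (r : Fin 2) (x : Set.Icc 1 D) :
    Antitone (sendOutcome lam u r x) := fun _ _ hij =>
  add_le_add (request_mul_age_mono r (antitone_attemptAge x hij))
    (hu (stochasticLE_sentBelief hij) (antitone_attemptAge x hij))

theorem sendOutcome_mono (hu : CostMonotone u) (r : Fin 2) {x y : Set.Icc 1 D} (hxy : x ≤ y) :
    sendOutcome lam u r x ≤ sendOutcome lam u r y := fun b =>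
  add_le_add (request_mul_age_mono r (attemptAge_mono b hxy))
    (hu (StochasticLE.refl _) (attemptAge_mono b hxy))

theorem sendValue (hu : CostMonotone u) (r : Fin 2) : CostMonotone (sendValue lam u r) :=
  fun β _ hβγ _ _ hxy => (hβγ _ (hu.antitone_sendOutcome r _)).trans
    (dotProduct_le_dotProduct_of_nonneg_left (hu.sendOutcome_mono r hxy) β.2.1)

theorem bellman (p : unitInterval) (hu : CostMonotone u) : CostMonotone (bellman p lam u) :=
  fun _ _ hβγ _ _ hxy => requestMean_mono p.2 fun r =>
    min_le_min (hu.waitValue r hβγ hxy) (hu.sendValue r hβγ hxy)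

end CostMonotone

theorem costMonotone_value (p lam : unitInterval) (n : ℕ) :
    CostMonotone (value (B := B) (D := D) p lam n) := by
  induction n with
  | zero => exact fun _ _ _ _ _ _ => le_rfl
  | succ n ih =>
    rw [value_succ]
    exact ih.bellman p

end CostMonotone

section Oscillation

variable {B D : ℕ} (p lam : unitInterval)

theorem sendValue_vertex (u : Law B × Set.Icc 1 D → ℝ) (r : Fin 2) (b : Fin (B + 1))
    (x : Set.Icc 1 D) :
    sendValue lam u r (stdSimplex.vertex b, x) = sendOutcome lam u r x b :=
  single_one_dotProduct _ _

theorem waitBelief_vertex_last :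
    waitBelief lam (stdSimplex.vertex (Fin.last B)) = stdSimplex.vertex (Fin.last B) := by
  have hup : levelUp (Fin.last B) = Fin.last B := Fin.ext (min_eq_right (Nat.le_succ B))
  have hcol : (Lam B lam).mulVec (Pi.single (Fin.last B) 1) = Pi.single (Fin.last B) 1 := by
    rw [Matrix.mulVec_single_one, Lam_col_eq, hup, ← add_smul, sub_add_cancel, one_smul]
  exact Subtype.ext hcol

/-- The state with an empty battery and the oldest information. -/
def worstState (B D : ℕ) [NeZero D] : Law B × Set.Icc 1 D := (stdSimplex.vertex 0, iccMax D)

/-- The state right after an update sent with a full battery. -/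
def freshState (B D : ℕ) [NeZero D] (lam : unitInterval) : Law B × Set.Icc 1 D :=
  (sentBelief lam (Fin.last B), ageOne (iccMax D))

theorem value_le_worstState [NeZero D] (n : ℕ) (y : Law B × Set.Icc 1 D) :
    value p lam n y ≤ value p lam n (worstState B D) :=
  costMonotone_value p lam n (StochasticLE.single_zero_le y.1.2) y.2.2.2

theorem value_vertex_last_le [NeZero D] (n : ℕ) (y : Law B × Set.Icc 1 D) :
    value p lam n (stdSimplex.vertex (Fin.last B), ageOne (iccMax D)) ≤ value p lam n y :=
  costMonotone_value p lam n (StochasticLE.le_single_last y.1.2) (ageOne_le _ _)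

theorem sendOutcome_last [NeZero B] [NeZero D] (u : Law B × Set.Icc 1 D → ℝ) (r : Fin 2)
    (x : Set.Icc 1 D) :
    sendOutcome lam u r x (Fin.last B) = (r : ℕ) + u (freshState B D lam) := by
  rw [sendOutcome, attemptAge_of_ne_zero x Fin.last_pos'.ne']
  simp only [ageOne, Nat.cast_one, mul_one]
  rfl

theorem value_freshState_sub_le [NeZero B] [NeZero D] (n : ℕ) (x : Set.Icc 1 D) :
    value p lam n (freshState B D lam) - saturationCost x ≤
      value p lam n (stdSimplex.vertex (Fin.last B), x) := by
  induction n generalizing x with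
  | zero => simpa [value_zero] using (Nat.cast_nonneg D).trans (le_saturationCost x)
  | succ n ih =>
    have hwait (r : Fin 2) : value p lam n (freshState B D lam) - saturationCost x +
        (r : ℕ) * D ≤ waitValue lam (value p lam n) r (stdSimplex.vertex (Fin.last B), x) := by
      rw [waitValue, waitBelief_vertex_last]
      linarith [ih (ageStep x), saturationCost_ageStep_add_le x r]
    have hsend (r : Fin 2) : value p lam n (freshState B D lam) - saturationCost x +
        (r : ℕ) * D ≤ sendValue lam (value p lam n) r (stdSimplex.vertex (Fin.last B), x) := by
      rw [sendValue_vertex, sendOutcome_last]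
      linarith [request_mul_le (D := D) r, le_saturationCost x, Nat.cast_nonneg (α := ℝ) r.1]
    have hstep := value_succ_le p lam n (freshState B D lam)
    rw [value_succ p lam n] at hstep ⊢
    linarith [le_bellman (p := p) hwait hsend]

theorem value_add_le_wait [NeZero D] (n k : ℕ) (β : Law B) :
    value p lam (n + k) (β, iccMax D) ≤
      k * D + value p lam n ((waitBelief lam)^[k] β, iccMax D) := by
  induction k generalizing β with
  | zero => simp
  | succ k ih =>
    have hwait := bellman_le_wait p lam (value p lam (n + k)) (β, iccMax D)
    have hpD : p * (D : ℝ) ≤ D := mul_le_of_le_one_left (Nat.cast_nonneg D) p.2.2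
    rw [ageStep_iccMax] at hwait
    rw [← add_assoc, value_succ, Function.iterate_succ_apply]
    push_cast
    linarith [ih (waitBelief lam β)]

theorem pow_le_iterate_waitBelief_vertex_zero (b : Fin (B + 1)) :
    (lam : ℝ) ^ b.1 ≤ ((waitBelief lam)^[b.1] (stdSimplex.vertex 0)).1 b := by
  induction b using Fin.induction with
  | zero => simp
  | succ b ih =>
    rw [Fin.val_succ, Function.iterate_succ_apply']
    set β := (waitBelief lam)^[b.1] (stdSimplex.vertex (0 : Fin (B + 1)))
    calc (lam : ℝ) ^ (b.1 + 1) = lam * lam ^ b.1 := pow_succ' _ _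
      _ ≤ lam * β.1 b.castSucc := mul_le_mul_of_nonneg_left ih lam.2.1
      _ = Lam B lam b.succ b.castSucc * β.1 b.castSucc := by simp [Lam, Fin.ext_iff]
      _ ≤ ∑ j, Lam B lam b.succ j * β.1 j :=
        Finset.single_le_sum (f := fun j => Lam B lam b.succ j * β.1 j)
          (fun j _ => mul_nonneg ((Lam_mem_colStochastic lam.2).1 _ j) (β.2.1 j))
          (Finset.mem_univ _)

theorem value_succ_le_send [NeZero B] [NeZero D] (n : ℕ) (γ : Law B) :
    value p lam (n + 1) (γ, iccMax D) ≤ D + value p lam n (worstState B D) -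
      γ.1 (Fin.last B) *
        (value p lam n (worstState B D) - value p lam n (freshState B D lam)) := by
  rw [value_succ]
  refine bellman_le_of_sendValue_le fun r => ?_
  set m := value p lam n (worstState B D)
  set g := value p lam n (freshState B D lam)
  have hD : (1 : ℝ) ≤ D := by exact_mod_cast NeZero.one_le (n := D)
  have hbound (b : Fin (B + 1)) : sendOutcome lam (value p lam n) r (iccMax D) b ≤
      D + m + Pi.single (M := fun _ => ℝ) (Fin.last B) (g - m) b := by
    rcases eq_or_ne b (Fin.last B) with rfl | hb
    · rw [sendOutcome_last, Pi.single_eq_same]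
      linarith [request_le_one r]
    · rw [Pi.single_eq_of_ne hb, add_zero]
      exact add_le_add ((request_mul_age_le _ r).trans (request_mul_le r))
        (value_le_worstState p lam n _)
  calc sendValue lam (value p lam n) r (γ, iccMax D)
      ≤ γ.1 ⬝ᵥ ((fun _ => D + m) + Pi.single (Fin.last B) (g - m)) :=
        dotProduct_le_dotProduct_of_nonneg_left hbound γ.2.1
    _ = D + m + γ.1 (Fin.last B) * (g - m) := by
        rw [dotProduct_add, dotProduct_const_of_mem_stdSimplex γ.2, dotProduct_single]
    _ = D + m - γ.1 (Fin.last B) * (m - g) := by ring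

variable {lam}

theorem value_worstState_sub_contract [NeZero B] [NeZero D] (n : ℕ) :
    value p lam (n + (B + 1)) (worstState B D) -
        value p lam (n + (B + 1)) (freshState B D lam) ≤
      (B + 1) * D + (1 - (lam : ℝ) ^ B) *
        (value p lam n (worstState B D) - value p lam n (freshState B D lam)) := by
  set gap := value p lam n (worstState B D) - value p lam n (freshState B D lam) with hgap
  have hgap_nonneg : 0 ≤ gap := sub_nonneg.2 (value_le_worstState p lam n _)
  set γ : Law B := (waitBelief lam)^[B] (stdSimplex.vertex 0)
  have hwait : value p lam (n + (B + 1)) (worstState B D) ≤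
      B * D + value p lam (n + 1) (γ, iccMax D) := by
    rw [← add_assoc, add_right_comm]
    exact value_add_le_wait p lam (n + 1) B _
  have hcharged : (lam : ℝ) ^ B * gap ≤ γ.1 (Fin.last B) * gap :=
    mul_le_mul_of_nonneg_right (pow_le_iterate_waitBelief_vertex_zero lam (Fin.last B)) hgap_nonneg
  have hmono : value p lam n (freshState B D lam) ≤
      value p lam (n + (B + 1)) (freshState B D lam) :=
    value_monotone p lam (Nat.le_add_right _ _) _
  linarith [value_succ_le_send (D := D) p lam n γ, hgap]

theorem value_worstState_sub_le [NeZero B] [NeZero D] (hlam : 0 < lam) (n : ℕ) :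
    value p lam n (worstState B D) - value p lam n (freshState B D lam) ≤
      (B + 1) * D / (lam : ℝ) ^ B := by
  have hpos : 0 < (lam : ℝ) ^ B := pow_pos hlam B
  have hle : (lam : ℝ) ^ B ≤ 1 := pow_le_one₀ lam.2.1 lam.2.2
  induction n using Nat.strong_induction_on with
  | _ n ih =>
    rcases lt_or_ge n (B + 1) with hn | hn
    · have hworst : value p lam n (worstState B D) ≤ n * D := by
        have hwait := value_add_le_wait (D := D) p lam 0 n (worstState B D).1
        rwa [zero_add, value_zero, Pi.zero_apply, add_zero] at hwait
      have hfresh : 0 ≤ value p lam n (freshState B D lam) :=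
        value_monotone p lam (Nat.zero_le n) _
      calc value p lam n (worstState B D) - value p lam n (freshState B D lam)
          ≤ n * D := by linarith
        _ ≤ (B + 1) * D := by gcongr; exact_mod_cast hn.le
        _ ≤ (B + 1) * D / (lam : ℝ) ^ B := le_div_self (by positivity) hpos hle
    · obtain ⟨k, rfl⟩ := Nat.exists_eq_add_of_le' hn
      calc _ ≤ (B + 1) * D + (1 - (lam : ℝ) ^ B) * ((B + 1) * D / (lam : ℝ) ^ B) :=
            (value_worstState_sub_contract p k).trans (add_le_add_right
              (mul_le_mul_of_nonneg_left (ih k (by omega)) (sub_nonneg.2 hle)) _)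
        _ = (B + 1) * D / (lam : ℝ) ^ B := by field_simp; ring

theorem waitBelief_zero : waitBelief (B := B) 0 = id :=
  funext fun β => Subtype.ext (by simp [waitBelief, Lam_zero])

theorem value_vertex_ge_of_no_arrivals (p : unitInterval) (n : ℕ) (j : Fin (B + 1))
    (x : Set.Icc 1 D) :
    n * ((p : ℝ) * D) - j.1 * (D * D) - saturationCost x ≤
      value p 0 n (stdSimplex.vertex j, x) := by
  induction n generalizing j x with
  | zero =>
    have hx := (Nat.cast_nonneg D).trans (le_saturationCost x)
    have hj : (0 : ℝ) ≤ j.1 * (D * D) := by positivity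
    simp only [value_zero, Nat.cast_zero, zero_mul, Pi.zero_apply]
    linarith
  | succ n ih =>
    have hwait (r : Fin 2) : n * ((p : ℝ) * D) - j.1 * (D * D) - saturationCost x +
        (r : ℕ) * D ≤ waitValue 0 (value p 0 n) r (stdSimplex.vertex j, x) := by
      rw [waitValue, waitBelief_zero, id]
      linarith [ih j (ageStep x), saturationCost_ageStep_add_le x r]
    have hsend (r : Fin 2) : n * ((p : ℝ) * D) - j.1 * (D * D) - saturationCost x +
        (r : ℕ) * D ≤ sendValue 0 (value p 0 n) r (stdSimplex.vertex j, x) := by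
      rw [sendValue_vertex]
      rcases eq_or_ne j 0 with rfl | hj
      · rw [sendOutcome, attemptAge_zero, sentBelief, waitBelief_zero, id]
        rw [show levelDown (0 : Fin (B + 1)) = 0 from rfl]
        linarith [ih 0 (ageStep x), saturationCost_ageStep_add_le x r]
      · rw [sendOutcome, attemptAge_of_ne_zero x hj, sentBelief, waitBelief_zero, id]
        have hdown : ((levelDown j).1 : ℝ) = j.1 - 1 := Nat.cast_pred (Fin.pos_of_ne_zero hj)
        have hih := ih (levelDown j) (ageOne x)
        rw [hdown] at hih
        have hage : (0 : ℝ) ≤ (r : ℕ) * (ageOne x).1 := by positivity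
        linarith [saturationCost_le (ageOne x), le_saturationCost x, request_mul_le (D := D) r]
    rw [value_succ]
    push_cast
    linarith [le_bellman (p := p) hwait hsend]

theorem exists_abs_value_sub_le (p lam : unitInterval) [NeZero B] [NeZero D] :
    ∃ (G : ℕ → ℝ) (K : ℝ), ∀ n (y : Law B × Set.Icc 1 D), |value p lam n y - G n| ≤ K := by
  rcases lam.2.1.eq_or_lt with hlam | hlam
  · obtain rfl : lam = 0 := Subtype.ext hlam.symm
    refine ⟨fun n => n * (p * D), B * (D * D) + D * D, fun n y => abs_le.2 ⟨?_, ?_⟩⟩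
    · have hlast := value_vertex_ge_of_no_arrivals p n (Fin.last B) (ageOne (iccMax D))
      rw [Fin.val_last] at hlast
      linarith [value_vertex_last_le p 0 n y, saturationCost_le (ageOne (iccMax D))]
    · have hK : (0 : ℝ) ≤ B * (D * D) + D * D := by positivity
      linarith [value_le_mul p 0 n y]
  · refine ⟨fun n => value p lam n (freshState B D lam), D * D + (B + 1) * D / (lam : ℝ) ^ B,
      fun n y => abs_le.2 ⟨?_, ?_⟩⟩
    · have hK : (0 : ℝ) ≤ (B + 1) * D / (lam : ℝ) ^ B := by positivity
      linarith [value_freshState_sub_le (B := B) p lam n (ageOne (iccMax D)),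
        value_vertex_last_le p lam n y, saturationCost_le (ageOne (iccMax D))]
    · have hK : (0 : ℝ) ≤ D * D := by positivity
      linarith [value_worstState_sub_le (B := B) (D := D) p hlam n, value_le_worstState p lam n y]

theorem exists_bellman_eq_const_add (p lam : unitInterval) [NeZero B] [NeZero D] :
    ∃ (C : ℝ) (u : Law B × Set.Icc 1 D → ℝ),
      (∃ M, ∀ y, |u y| ≤ M) ∧ ∀ y, bellman p lam u y = C + u y := by
  obtain ⟨G, K, hK⟩ := exists_abs_value_sub_le (B := B) (D := D) p lam
  have : Nonempty (Law B × Set.Icc 1 D) := ⟨worstState B D⟩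
  exact (isTopical_bellman p lam).exists_additive_eigenvector (continuous_bellman p lam) hK

end Oscillation

/-! ### Solutions of the Bellman equation -/

variable {B D : ℕ}

section ActionValue

variable {p lam : ℝ} (h : BeliefState B D → ℝ)

/-- The last reported battery level after an attempted update, when the battery level is `b`. -/
def attemptLevel (k : Set.Icc 1 B) (b : Fin (B + 1)) : Set.Icc 1 B :=
  if hb : b = 0 then k else ⟨b.1, Nat.pos_of_ne_zero (Fin.val_ne_zero_iff.2 hb), b.is_le⟩

/-- The age and the last reported battery level after an attempted update. -/
def attemptReport (k : Set.Icc 1 D × Set.Icc 1 B) (b : Fin (B + 1)) :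
    Set.Icc 1 D × Set.Icc 1 B :=
  (attemptAge k.1 b, attemptLevel k.2 b)

theorem attemptReport_zero (k : Set.Icc 1 D × Set.Icc 1 B) :
    attemptReport k 0 = (ageStep k.1, k.2) := rfl

theorem attemptReport_level (k : Set.Icc 1 D × Set.Icc 1 B) (j : Set.Icc 1 B) :
    attemptReport k (level j) = (ageOne k.1, j) :=
  Prod.ext (attemptAge_of_ne_zero k.1 (level_ne_zero j)) (dif_neg (level_ne_zero j))

/-- The value of an attempted update, as a function of the battery level, when `o` was observed and
the relative value function is `h`. -/
def attemptOutcome (p lam : ℝ) (h : BeliefState B D → ℝ) (o : Obs B D) (b : Fin (B + 1)) : ℝ :=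
  (o.1 : ℕ) * (attemptAge o.2.1 b).1 +
    requestMean p fun r' => h (rho B lam b.1, r', attemptReport o.2 b)

theorem cast_ageStep (x : Set.Icc 1 D) : ((ageStep x).1 : ℝ) = min ((x.1 : ℝ) + 1) D := by
  simp [ageStep]

theorem sum_request_eq_requestMean (p : ℝ) (φ : Fin 2 → ℝ) :
    ∑ r' : Fin 2, (((r' : ℕ) : ℝ) * p + (1 - ((r' : ℕ) : ℝ)) * (1 - p)) * φ r' =
      requestMean p φ := by
  simp only [Fin.sum_univ_two, requestMean, Fin.val_zero, Fin.val_one, Nat.cast_zero, Nat.cast_one]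
  ring

theorem Q_zero (β : Belief B) (o : Obs B D) :
    Q p lam h (β, o) 0 = (o.1 : ℕ) * (ageStep o.2.1).1 +
      requestMean p fun r' => h ((Lam B lam).mulVec β, r', ageStep o.2.1, o.2.2) := by
  simp only [Q, if_true, sum_request_eq_requestMean, cast_ageStep]

theorem Q_one {β : Belief B} (hβ : β ∈ stdSimplex ℝ (Fin (B + 1))) (o : Obs B D) :
    Q p lam h (β, o) 1 = β ⬝ᵥ attemptOutcome p lam h o := by
  have hsum : ∑ j : Set.Icc 1 B, β (level j) = 1 - β 0 :=
    eq_sub_of_add_eq' ((sum_eq_zero_add_sum_level β).symm.trans hβ.2)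
  have hlevel (j : Set.Icc 1 B) : attemptOutcome p lam h o (level j) =
      (o.1 : ℕ) + requestMean p fun r' => h (rho B lam j.1, r', ageOne o.2.1, j) := by
    rw [attemptOutcome, attemptReport_level, attemptAge_of_ne_zero _ (level_ne_zero j)]
    simp only [ageOne, Nat.cast_one, mul_one]
    rfl
  rw [dotProduct, sum_eq_zero_add_sum_level]
  simp only [hlevel, mul_add, Finset.sum_add_distrib, ← Finset.sum_mul, hsum]
  simp only [Q, one_ne_zero, if_false, sum_request_eq_requestMean, attemptOutcome,
    attemptReport_zero, attemptAge_zero, cast_ageStep]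
  simp only [requestMean, Fin.val_zero]
  ring

variable {h}

theorem Q_le_add (hp : p ∈ unitInterval) {S : Set (Belief B)} (hS : IsBeliefSpace lam S)
    {h' : BeliefState B D → ℝ} {c : ℝ} (hc : ∀ z : BeliefState B D, z.1 ∈ S → h z ≤ h' z + c)
    {z : BeliefState B D} (hz : z.1 ∈ S) (a : Action) : Q p lam h z a ≤ Q p lam h' z a + c := by
  obtain ⟨β, o⟩ := z
  have hmean {γ : Belief B} (hγ : γ ∈ S) (k : Set.Icc 1 D × Set.Icc 1 B) :
      requestMean p (fun r' => h (γ, r', k)) ≤ requestMean p (fun r' => h' (γ, r', k)) + c :=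
    (requestMean_mono hp fun r' => hc (γ, r', k) hγ).trans_eq (requestMean_add_const _ _ _)
  have hattempt : attemptOutcome p lam h o ≤ attemptOutcome p lam h' o + fun _ => c :=
    fun b => (add_le_add_right (hmean (hS.2.1 b.1 b.is_le) _) _).trans_eq (add_assoc _ _ _).symm
  match a with
  | 0 =>
    rw [Q_zero, Q_zero, add_assoc]
    exact add_le_add_right (hmean (hS.2.2 β hz) _) _
  | 1 =>
    rw [Q_one h (hS.1 hz), Q_one h' (hS.1 hz), ← dotProduct_const_of_mem_stdSimplex (hS.1 hz) c,
      ← dotProduct_add]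
    exact dotProduct_le_dotProduct_of_nonneg_left hattempt (hS.1 hz).1

end ActionValue

namespace SolvesBellman

variable {p lam : ℝ} {S : Set (Belief B)} {C C' : ℝ} {h h' : BeliefState B D → ℝ} [NeZero B]
  [NeZero D]

theorem const_le (hh : SolvesBellman p lam S C h) (hh' : SolvesBellman p lam S C' h')
    (hp : p ∈ unitInterval) (hS : IsBeliefSpace lam S) (hb : BoundedOn S h)
    (hb' : BoundedOn S h') : C ≤ C' := by
  obtain ⟨K, hK⟩ := hb
  obtain ⟨K', hK'⟩ := hb'
  let Z := {z : BeliefState B D // z.1 ∈ S}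
  have : Nonempty Z := ⟨(rho B lam 0, 0, iccMax D, iccMax B), hS.2.1 0 (Nat.zero_le B)⟩
  have hbdd : BddAbove (Set.range fun z : Z => h z.1 - h' z.1) := ⟨K + K', by
    rintro _ ⟨z, rfl⟩
    linarith [(abs_le.1 (hK z.1 z.2)).2, (abs_le.1 (hK' z.1 z.2)).1]⟩
  set c := ⨆ z : Z, h z.1 - h' z.1
  have hc (z : BeliefState B D) (hz : z.1 ∈ S) : h z ≤ h' z + c :=
    sub_le_iff_le_add'.1 (le_ciSup hbdd ⟨z, hz⟩)
  have himproved : c ≤ c - (C - C') := ciSup_le fun ⟨z, hz⟩ => by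
    have hmin := min_le_min (Q_le_add hp hS hc hz 0) (Q_le_add hp hS hc hz 1)
    rw [min_add_add_right, ← hh z hz, ← hh' z hz] at hmin
    linarith
  linarith

theorem const_unique (hh : SolvesBellman p lam S C h) (hh' : SolvesBellman p lam S C' h')
    (hp : p ∈ unitInterval) (hS : IsBeliefSpace lam S) (hb : BoundedOn S h)
    (hb' : BoundedOn S h') : C = C' :=
  le_antisymm (hh.const_le hh' hp hS hb hb') (hh'.const_le hh hp hS hb' hb)

end SolvesBellman

section LiftValue

variable {p lam : unitInterval} {C : ℝ} {u : Law B × Set.Icc 1 D → ℝ}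

/-- The relative value function on belief-states determined by a solution `(C, u)` of the optimality
equation of the reduced problem. -/
def liftValue (lam : unitInterval) (C : ℝ) (u : Law B × Set.Icc 1 D → ℝ) (z : BeliefState B D) :
    ℝ :=
  open Classical in
  if hz : z.1 ∈ stdSimplex ℝ (Fin (B + 1)) then stageValue lam u z.2.1 (⟨z.1, hz⟩, z.2.2.1) - C
  else 0

theorem liftValue_of_law (β : Law B) (o : Obs B D) :
    liftValue lam C u (β.1, o) = stageValue lam u o.1 (β, o.2.1) - C := dif_pos β.2

theorem requestMean_liftValue (hu : ∀ y, bellman p lam u y = C + u y) (β : Law B)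
    (x : Set.Icc 1 D) (k : Set.Icc 1 B) :
    requestMean p (fun r' => liftValue lam C u (β.1, r', x, k)) = u (β, x) := by
  simp only [liftValue_of_law, sub_eq_add_neg, requestMean_add_const]
  rw [← sub_eq_add_neg, sub_eq_iff_eq_add']
  exact hu (β, x)

theorem coe_sentBelief [NeZero B] (b : Fin (B + 1)) : (sentBelief lam b).1 = rho B lam b.1 := by
  rw [rho_eq_Lam_col]
  exact Matrix.mulVec_single_one (Lam B lam) (levelDown b)

theorem Q_zero_liftValue (hu : ∀ y, bellman p lam u y = C + u y) (β : Law B) (o : Obs B D) :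
    Q p lam (liftValue lam C u) (β.1, o) 0 = waitValue lam u o.1 (β, o.2.1) := by
  rw [Q_zero]
  exact congrArg _ (requestMean_liftValue hu (waitBelief lam β) _ _)

theorem Q_one_liftValue [NeZero B] (hu : ∀ y, bellman p lam u y = C + u y) (β : Law B)
    (o : Obs B D) : Q p lam (liftValue lam C u) (β.1, o) 1 = sendValue lam u o.1 (β, o.2.1) := by
  rw [Q_one _ β.2]
  refine congrArg (β.1 ⬝ᵥ ·) (funext fun b => ?_)
  rw [attemptOutcome, ← coe_sentBelief, sendOutcome]
  exact congrArg _ (requestMean_liftValue hu (sentBelief lam b) _ _)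

theorem solvesBellman_liftValue [NeZero B] (hu : ∀ y, bellman p lam u y = C + u y) :
    SolvesBellman p lam (stdSimplex ℝ (Fin (B + 1))) C (liftValue lam C u) := fun ⟨β, o⟩ hβ => by
  rw [Q_zero_liftValue hu ⟨β, hβ⟩, Q_one_liftValue hu ⟨β, hβ⟩, liftValue_of_law ⟨β, hβ⟩,
    add_sub_cancel]
  rfl

theorem boundedOn_liftValue {M : ℝ} (hM : ∀ y, |u y| ≤ M) :
    BoundedOn (stdSimplex ℝ (Fin (B + 1))) (liftValue lam C u) := by
  refine ⟨M + D + |C|, fun ⟨β, o⟩ hβ => ?_⟩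
  rw [liftValue_of_law ⟨β, hβ⟩]
  set y : Law B × Set.Icc 1 D := (⟨β, hβ⟩, o.2.1)
  have hle : stageValue lam u o.1 y ≤ M + D :=
    (stageValue_le_wait lam u o.1 y).trans
      (add_le_add ((le_abs_self _).trans (hM _)) (request_mul_le o.1))
  have hge : 0 ≤ stageValue lam u o.1 y + M := by
    rw [← stageValue_add_const]
    exact stageValue_nonneg lam o.1 (fun z => neg_le_iff_add_nonneg.1 (abs_le.1 (hM z)).1) y
  have hstage : |stageValue lam u o.1 y| ≤ M + D :=
    abs_le.2 ⟨by linarith [Nat.cast_nonneg (α := ℝ) D], hle⟩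
  exact (abs_sub _ _).trans (add_le_add_left hstage _)

end LiftValue

theorem exists_solvesBellman [NeZero B] [NeZero D] {p lam : ℝ} (hp : p ∈ unitInterval)
    (hlam : lam ∈ unitInterval) :
    ∃ (C : ℝ) (h : BeliefState B D → ℝ), BoundedOn (stdSimplex ℝ (Fin (B + 1))) h ∧
      SolvesBellman p lam (stdSimplex ℝ (Fin (B + 1))) C h := by
  obtain ⟨C, u, ⟨M, hM⟩, hu⟩ := exists_bellman_eq_const_add (B := B) (D := D) ⟨p, hp⟩ ⟨lam, hlam⟩
  exact ⟨C, liftValue ⟨lam, hlam⟩ C u, boundedOn_liftValue hM, solvesBellman_liftValue hu⟩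

/-! ### The belief-state Markov decision process -/

section Transition

variable {p lam : ℝ}

/-- The age and the last reported battery level after action `a`, when the battery level is `b`. -/
def report (a : Action) (k : Set.Icc 1 D × Set.Icc 1 B) (b : Fin (B + 1)) :
    Set.Icc 1 D × Set.Icc 1 B :=
  if a = 1 then attemptReport k b else (ageStep k.1, k.2)

theorem report_zero (k : Set.Icc 1 D × Set.Icc 1 B) (b : Fin (B + 1)) :
    report 0 k b = (ageStep k.1, k.2) := rfl

theorem report_one (k : Set.Icc 1 D × Set.Icc 1 B) (b : Fin (B + 1)) :
    report 1 k b = attemptReport k b := rfl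

theorem knowledgeProb_eq_ite (a : Action) (k k' : Set.Icc 1 D × Set.Icc 1 B) (b : Fin (B + 1)) :
    knowledgeProb b k.1 k.2 a k'.1 k'.2 = if k' = report a k b then 1 else 0 := by
  match a with
  | 0 => simp [knowledgeProb, report_zero, Prod.ext_iff]
  | 1 =>
    rcases eq_or_ne b 0 with rfl | hb
    · simp [knowledgeProb, report_one, attemptReport_zero, Prod.ext_iff]
    · obtain ⟨j, rfl⟩ := exists_level_eq hb
      have hval : (level j).1 = j.1 := rfl
      rw [report_one, attemptReport_level]
      simp [knowledgeProb, hval, j.2.1, ageOne, Prod.ext_iff, Subtype.ext_iff]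

theorem transProb_eq (s s' : State B D) (a : Action) :
    transProb p lam s a s' = requestProb p s'.2.1 * batteryProb lam s.1 a s'.1 *
      if s'.2.2 = report a s.2.2 s.1 then 1 else 0 :=
  congrArg _ (knowledgeProb_eq_ite a s.2.2 s'.2.2 s.1)

theorem cost_eq (b : Fin (B + 1)) (o : Obs B D) (a : Action) :
    cost (b, o) a = (o.1 : ℕ) * (report a o.2 b).1.1 := by
  have hD : (1 : ℝ) ≤ D := by exact_mod_cast o.2.1.2.1.trans o.2.1.2.2
  match a with
  | 0 => simp [cost, report_zero, cast_ageStep]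
  | 1 =>
    rcases eq_or_ne b 0 with rfl | hb
    · simp [cost, report_one, attemptReport_zero, cast_ageStep]
    · have hb' : 1 ≤ b.1 := Fin.pos_of_ne_zero hb
      simp [cost, report_one, attemptReport, attemptAge_of_ne_zero _ hb, ageOne, hb', hD]

theorem sum_requestProb_mul (φ : Fin 2 → ℝ) : ∑ r, requestProb p r * φ r = requestMean p φ := by
  simp only [Fin.sum_univ_two, requestProb, requestMean, Fin.zero_eq_one_iff, if_true]
  exact add_comm _ _

theorem batteryProb_mem_stdSimplex [NeZero B] (hlam : lam ∈ unitInterval) (b : Fin (B + 1))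
    (a : Action) : batteryProb lam b a ∈ stdSimplex ℝ (Fin (B + 1)) := by
  have hcol (j : Fin (B + 1)) : (Lam B lam).col j ∈ stdSimplex ℝ (Fin (B + 1)) := by
    rw [← Matrix.mulVec_single_one]
    exact mulVec_mem_stdSimplex (Lam_mem_colStochastic hlam) (single_mem_stdSimplex ℝ j)
  match a with
  | 0 => exact funext (batteryProb_zero b) ▸ hcol b
  | 1 =>
    rw [show batteryProb lam b 1 = rho B lam b.1 from funext (batteryProb_one b), rho_eq_Lam_col]
    exact hcol _

theorem sum_transProb_mul_request [NeZero B] (hlam : lam ∈ unitInterval) (s : State B D)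
    (a : Action) (φ : Fin 2 → ℝ) :
    ∑ s', transProb p lam s a s' * φ s'.2.1 = requestMean p φ := by
  have hbattery (b' : Fin (B + 1)) : ∑ o', transProb p lam s a (b', o') * φ o'.1 =
      batteryProb lam s.1 a b' * requestMean p φ := by
    rw [← sum_requestProb_mul, Finset.mul_sum, Fintype.sum_prod_type]
    refine Finset.sum_congr rfl fun r' _ => ?_
    simp only [transProb_eq, mul_ite, mul_one, mul_zero, ite_mul, zero_mul, Finset.sum_ite_eq',
      Finset.mem_univ, if_true]
    ring
  rw [Fintype.sum_prod_type]
  simp only [hbattery, ← Finset.sum_mul, (batteryProb_mem_stdSimplex hlam s.1 a).2, one_mul]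

theorem transProb_nonneg [NeZero B] (hp : p ∈ unitInterval) (hlam : lam ∈ unitInterval)
    (s s' : State B D) (a : Action) : 0 ≤ transProb p lam s a s' := by
  have hrequest : 0 ≤ requestProb p s'.2.1 := by
    rw [requestProb]
    split_ifs
    exacts [hp.1, sub_nonneg.2 hp.2]
  rw [transProb_eq]
  exact mul_nonneg (mul_nonneg hrequest ((batteryProb_mem_stdSimplex hlam s.1 a).1 _))
    (by split_ifs <;> norm_num)

end Transition

section BayesUpdate

variable {p lam : ℝ} {z : BeliefState B D} {a : Action}

/-- The unnormalized conditional law of the battery level after action `a` and next observation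
`o'`. The belief in `z` may be any vector. -/
def filterStep (p lam : ℝ) (z : BeliefState B D) (a : Action) (o' : Obs B D) : Belief B :=
  fun j => ∑ b, z.1 b * transProb p lam (b, z.2) a (j, o')

theorem bayesUpdate_apply (o' : Obs B D) (j : Fin (B + 1)) :
    bayesUpdate p lam z a o' j = filterStep p lam z a o' j / obsProb p lam z a o' := rfl

theorem obsProb_eq_sum_filterStep (o' : Obs B D) :
    obsProb p lam z a o' = ∑ j, filterStep p lam z a o' j := by
  simp only [obsProb, filterStep, Finset.mul_sum]
  exact Finset.sum_comm

theorem filterStep_apply (r' : Fin 2) (k' : Set.Icc 1 D × Set.Icc 1 B) (j : Fin (B + 1)) :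
    filterStep p lam z a (r', k') j = requestProb p r' *
      ∑ b, if k' = report a z.2.2 b then z.1 b * batteryProb lam b a j else 0 := by
  simp only [filterStep, transProb_eq, Finset.mul_sum]
  refine Finset.sum_congr rfl fun b _ => ?_
  split_ifs <;> ring

theorem sum_obsProb_mul_request [NeZero B] (hlam : lam ∈ unitInterval)
    (hz : z.1 ∈ stdSimplex ℝ (Fin (B + 1))) (a : Action) (φ : Fin 2 → ℝ) :
    ∑ o', obsProb p lam z a o' * φ o'.1 = requestMean p φ := by
  have hnext (b : Fin (B + 1)) :
      ∑ b', ∑ o', transProb p lam (b, z.2) a (b', o') * φ o'.1 = requestMean p φ := by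
    rw [← sum_transProb_mul_request hlam (b, z.2) a φ, Fintype.sum_prod_type]
  simp only [obsProb, Finset.sum_mul]
  rw [Finset.sum_comm, ← dotProduct_const_of_mem_stdSimplex hz (requestMean p φ)]
  refine Finset.sum_congr rfl fun b _ => ?_
  simp only [← hnext b, Finset.mul_sum, Finset.sum_mul, mul_assoc]
  exact Finset.sum_comm

/-- `S` is a set of probability vectors that Bayesian updating does not leave. -/
structure BayesInvariant (D : ℕ) (p lam : ℝ) (S : Set (Belief B)) : Prop where
  subset_stdSimplex : S ⊆ stdSimplex ℝ (Fin (B + 1))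
  bayesUpdate_mem : ∀ {z : BeliefState B D}, z.1 ∈ S → ∀ {a : Action} {o' : Obs B D},
    obsProb p lam z a o' ≠ 0 → bayesUpdate p lam z a o' ∈ S

theorem bayesInvariant_stdSimplex [NeZero B] (hp : p ∈ unitInterval) (hlam : lam ∈ unitInterval) :
    BayesInvariant D p lam (stdSimplex ℝ (Fin (B + 1))) where
  subset_stdSimplex := subset_rfl
  bayesUpdate_mem {z} hz {a} {o'} ho := by
    have hstep : 0 ≤ filterStep p lam z a o' := fun j =>
      Finset.sum_nonneg fun b _ => mul_nonneg (hz.1 b) (transProb_nonneg hp hlam _ _ _)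
    have hobs : 0 ≤ obsProb p lam z a o' := by
      rw [obsProb_eq_sum_filterStep]
      exact Finset.sum_nonneg fun j _ => hstep j
    refine ⟨fun j => div_nonneg (hstep j) hobs, ?_⟩
    simp only [bayesUpdate_apply, ← Finset.sum_div, ← obsProb_eq_sum_filterStep]
    exact div_self ho

/-- After action `a` in the belief-state `z`, the next age and the next reported level are `f i`
with probability `w i`, and observing `f i` turns the belief into `γ i`. -/
structure RevealsPosterior {ι : Type*} (p lam : ℝ) (z : BeliefState B D) (a : Action) (w : ι → ℝ)
    (f : ι → Set.Icc 1 D × Set.Icc 1 B) (γ : ι → Belief B) : Prop where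
  injective : Function.Injective f
  sum_eq_one : ∀ i, ∑ j, γ i j = 1
  filterStep_eq : ∀ r' i, filterStep p lam z a (r', f i) = (requestProb p r' * w i) • γ i
  filterStep_of_notMem : ∀ r', ∀ k' ∉ Set.range f, filterStep p lam z a (r', k') = 0

namespace RevealsPosterior

variable {ι : Type*} {w : ι → ℝ} {f : ι → Set.Icc 1 D × Set.Icc 1 B} {γ : ι → Belief B}

theorem obsProb_eq (hf : RevealsPosterior p lam z a w f γ) (r' : Fin 2) (i : ι) :
    obsProb p lam z a (r', f i) = requestProb p r' * w i := by
  simp only [obsProb_eq_sum_filterStep, hf.filterStep_eq, Pi.smul_apply, smul_eq_mul,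
    ← Finset.mul_sum, hf.sum_eq_one, mul_one]

theorem obsProb_of_notMem (hf : RevealsPosterior p lam z a w f γ) (r' : Fin 2)
    {k' : Set.Icc 1 D × Set.Icc 1 B} (hk : k' ∉ Set.range f) : obsProb p lam z a (r', k') = 0 := by
  simp only [obsProb_eq_sum_filterStep, hf.filterStep_of_notMem r' k' hk, Pi.zero_apply,
    Finset.sum_const_zero]

theorem bayesUpdate_eq (hf : RevealsPosterior p lam z a w f γ) {r' : Fin 2} {i : ι}
    (h : obsProb p lam z a (r', f i) ≠ 0) : bayesUpdate p lam z a (r', f i) = γ i := by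
  funext j
  rw [bayesUpdate_apply, hf.filterStep_eq, ← hf.obsProb_eq]
  exact mul_div_cancel_left₀ _ h

theorem exists_bayesUpdate_eq (hf : RevealsPosterior p lam z a w f γ) {o' : Obs B D}
    (h : obsProb p lam z a o' ≠ 0) : ∃ i, bayesUpdate p lam z a o' = γ i := by
  obtain ⟨r', k'⟩ := o'
  obtain ⟨i, rfl⟩ : k' ∈ Set.range f := by_contra fun hk => h (hf.obsProb_of_notMem r' hk)
  exact ⟨i, hf.bayesUpdate_eq h⟩

theorem sum_obsProb_mul [Fintype ι] (hf : RevealsPosterior p lam z a w f γ)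
    (h : BeliefState B D → ℝ) :
    ∑ o', obsProb p lam z a o' * h (bayesUpdate p lam z a o', o') =
      w ⬝ᵥ fun i => requestMean p fun r' => h (γ i, r', f i) := by
  have hreport (r' : Fin 2) : ∑ i, w i * (requestProb p r' * h (γ i, r', f i)) =
      ∑ k', obsProb p lam z a (r', k') * h (bayesUpdate p lam z a (r', k'), r', k') := by
    refine Fintype.sum_of_injective f hf.injective _ _ (fun k' hk => ?_) fun i => ?_
    · rw [hf.obsProb_of_notMem r' hk, zero_mul]
    · rcases eq_or_ne (obsProb p lam z a (r', f i)) 0 with hobs | hobs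
      · rw [hobs, zero_mul, mul_left_comm, ← mul_assoc, ← hf.obsProb_eq, hobs, zero_mul]
      · rw [hf.bayesUpdate_eq hobs, hf.obsProb_eq]
        ring
  rw [Fintype.sum_prod_type]
  simp only [← hreport, dotProduct, ← sum_requestProb_mul, Finset.mul_sum]
  exact Finset.sum_comm

end RevealsPosterior

theorem revealsPosterior_wait (hz : z.1 ∈ stdSimplex ℝ (Fin (B + 1)))
    (hlam : lam ∈ unitInterval) :
    RevealsPosterior p lam z 0 (fun _ : Unit => 1) (fun _ => (ageStep z.2.2.1, z.2.2.2))
      fun _ => (Lam B lam).mulVec z.1 where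
  injective _ _ _ := rfl
  sum_eq_one _ := (mulVec_mem_stdSimplex (Lam_mem_colStochastic hlam) hz).2
  filterStep_eq r' _ := by
    funext j
    simp [filterStep_apply, report_zero, batteryProb_zero, Matrix.mulVec, dotProduct, mul_comm]
  filterStep_of_notMem r' k' hk := by
    funext j
    have hk' : k' ≠ (ageStep z.2.2.1, z.2.2.2) := fun h => hk ⟨(), h.symm⟩
    simp [filterStep_apply, report_zero, hk']

theorem ageStep_ne_ageOne (hD : 2 ≤ D) (x : Set.Icc 1 D) : ageStep x ≠ ageOne x := fun h => by
  have hx := x.2.1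
  have hval : min (x.1 + 1) D = 1 := congrArg Subtype.val h
  omega

theorem attemptReport_injective (hD : 2 ≤ D) (k : Set.Icc 1 D × Set.Icc 1 B) :
    Function.Injective (attemptReport k) := fun b c hbc => by
  rcases eq_or_ne b 0 with rfl | hb <;> rcases eq_or_ne c 0 with rfl | hc
  · rfl
  · obtain ⟨j, rfl⟩ := exists_level_eq hc
    rw [attemptReport_level, attemptReport_zero] at hbc
    exact absurd (congrArg Prod.fst hbc) (ageStep_ne_ageOne hD k.1)
  · obtain ⟨i, rfl⟩ := exists_level_eq hb
    rw [attemptReport_level, attemptReport_zero] at hbc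
    exact absurd (congrArg Prod.fst hbc).symm (ageStep_ne_ageOne hD k.1)
  · obtain ⟨i, rfl⟩ := exists_level_eq hb
    obtain ⟨j, rfl⟩ := exists_level_eq hc
    rw [attemptReport_level, attemptReport_level] at hbc
    exact congrArg (fun k => level k.2) hbc

theorem revealsPosterior_attempt [NeZero B] (hD : 2 ≤ D) (hlam : lam ∈ unitInterval)
    (z : BeliefState B D) :
    RevealsPosterior p lam z 1 z.1 (attemptReport z.2.2) fun b => rho B lam b.1 where
  injective := attemptReport_injective hD z.2.2
  sum_eq_one b := by
    simpa only [batteryProb_one] using (batteryProb_mem_stdSimplex hlam b 1).2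
  filterStep_eq r' b := by
    funext j
    simp [filterStep_apply, report_one, batteryProb_one, (attemptReport_injective hD z.2.2).eq_iff,
      mul_assoc]
  filterStep_of_notMem r' k' hk := by
    funext j
    have hk' (b : Fin (B + 1)) : k' ≠ attemptReport z.2.2 b := fun h => hk ⟨b, h.symm⟩
    simp [filterStep_apply, report_one, hk']

theorem actionValue_eq_Q [NeZero B] (hD : 2 ≤ D) (hlam : lam ∈ unitInterval)
    (h : BeliefState B D → ℝ) (hz : z.1 ∈ stdSimplex ℝ (Fin (B + 1))) (a : Action) :
    actionValue p lam h z a = Q p lam h z a := by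
  obtain ⟨β, o⟩ := z
  simp only [actionValue, cost_eq]
  match a with
  | 0 =>
    rw [Q_zero, (revealsPosterior_wait hz hlam).sum_obsProb_mul h]
    simp only [report_zero, dotProduct, Finset.univ_unique, Finset.sum_singleton, one_mul]
    exact congrArg (· + _) (dotProduct_const_of_mem_stdSimplex hz _)
  | 1 =>
    rw [Q_one h hz, (revealsPosterior_attempt hD hlam _).sum_obsProb_mul h]
    exact (dotProduct_add _ _ _).symm

theorem IsBeliefSpace.bayesInvariant [NeZero B] (hD : 2 ≤ D) (hlam : lam ∈ unitInterval)
    {S : Set (Belief B)} (hS : IsBeliefSpace lam S) : BayesInvariant D p lam S where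
  subset_stdSimplex := hS.1
  bayesUpdate_mem {z} hz {a} {_} ho := by
    match a with
    | 0 =>
      obtain ⟨_, h⟩ := (revealsPosterior_wait (hS.1 hz) hlam).exists_bayesUpdate_eq ho
      exact h ▸ hS.2.2 z.1 hz
    | 1 =>
      obtain ⟨b, h⟩ := (revealsPosterior_attempt hD hlam z).exists_bayesUpdate_eq ho
      exact h ▸ hS.2.1 b.1 b.is_le

end BayesUpdate

section AgeCapOne

variable {p lam : ℝ} {z : BeliefState B 1} {S : Set (Belief B)}

theorem actionValue_request [NeZero B] (hlam : lam ∈ unitInterval)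
    (hz : z.1 ∈ stdSimplex ℝ (Fin (B + 1))) (a : Action) :
    actionValue p lam (fun z => ((z.2.1 : ℕ) : ℝ)) z a = p + (z.2.1 : ℕ) := by
  have hcost (b : Fin (B + 1)) : cost (b, z.2) a = (z.2.1 : ℕ) := by
    have hage : (report a z.2.2 b).1.1 = 1 := le_antisymm (report a z.2.2 b).1.2.2
      (report a z.2.2 b).1.2.1
    rw [cost_eq, hage, Nat.cast_one, mul_one]
  have hnext := sum_obsProb_mul_request (p := p) hlam hz a fun r => ((r : ℕ) : ℝ)
  rw [actionValue, hnext]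
  simp [hcost, ← Finset.sum_mul, hz.2, requestMean, add_comm]

theorem Q_request (hz : z.1 ∈ stdSimplex ℝ (Fin (B + 1))) (a : Action) :
    Q p lam (fun z => ((z.2.1 : ℕ) : ℝ)) z a = p + (z.2.1 : ℕ) := by
  have hage (x : Set.Icc 1 1) : x.1 = 1 := le_antisymm x.2.2 x.2.1
  obtain ⟨β, o⟩ := z
  match a with
  | 0 => simp [Q_zero, hage, requestMean, add_comm]
  | 1 =>
    rw [Q_one _ hz]
    have hout : attemptOutcome p lam (fun z => ((z.2.1 : ℕ) : ℝ)) o = fun _ => p + (o.1 : ℕ) := by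
      funext b
      simp [attemptOutcome, hage, requestMean, add_comm]
    rw [hout]
    exact dotProduct_const_of_mem_stdSimplex hz _

theorem boundedOn_request (S : Set (Belief B)) :
    BoundedOn (D := D) S fun z => ((z.2.1 : ℕ) : ℝ) :=
  ⟨1, fun z _ => (Nat.abs_cast _).trans_le (request_le_one z.2.1)⟩

theorem solvesBellman_request (hS : S ⊆ stdSimplex ℝ (Fin (B + 1))) :
    SolvesBellman (D := 1) p lam S p fun z => ((z.2.1 : ℕ) : ℝ) := fun z hz => by
  rw [Q_request (hS hz), Q_request (hS hz), min_self]

end AgeCapOne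

/-! ### Verification of optimality -/

section History

variable {t : ℕ} (μ : Traj B D t → ℝ) (o : Fin (t + 1) → Obs B D)

/-- The joint mass of the history `o` and the current battery level. -/
def jointMass : Belief B :=
  fun j => ∑ s : Traj B D t, if observe s = o ∧ (s (Fin.last t)).1 = j then μ s else 0

/-- The mass of the history `o`. -/
def historyMass : ℝ := ∑ s : Traj B D t, if observe s = o then μ s else 0

/-- The belief-state after the history `o`. -/
def historyState : BeliefState B D := (posterior μ o, o (Fin.last t))

theorem posterior_apply (j : Fin (B + 1)) : posterior μ o j = jointMass μ o j / historyMass μ o :=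
  rfl

theorem sum_jointMass : ∑ j, jointMass μ o j = historyMass μ o := by
  simp only [jointMass, historyMass, ite_and]
  rw [Finset.sum_comm]
  exact Finset.sum_congr rfl fun s _ => by split_ifs <;> simp

theorem sum_mul_eq_sum_jointMass (φ : (Fin (t + 1) → Obs B D) → Fin (B + 1) → ℝ) :
    ∑ s, μ s * φ (observe s) (s (Fin.last t)).1 = ∑ o, jointMass μ o ⬝ᵥ φ o := by
  have hhistory (o : Fin (t + 1) → Obs B D) : jointMass μ o ⬝ᵥ φ o =
      ∑ s, if observe s = o then μ s * φ (observe s) (s (Fin.last t)).1 else 0 := by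
    simp only [dotProduct, jointMass, Finset.sum_mul, ite_and]
    rw [Finset.sum_comm]
    refine Finset.sum_congr rfl fun s _ => ?_
    split_ifs with ho
    · simp [ho]
    · simp
  simp only [hhistory]
  rw [Finset.sum_comm]
  simp

variable {μ}

theorem jointMass_eq_smul_posterior (hμ : 0 ≤ μ) :
    jointMass μ o = historyMass μ o • posterior μ o := by
  funext j
  simp only [Pi.smul_apply, smul_eq_mul, posterior_apply]
  rcases eq_or_ne (historyMass μ o) 0 with ho | ho
  · have hnonneg (j : Fin (B + 1)) : 0 ≤ jointMass μ o j := Finset.sum_nonneg fun s _ => by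
      split_ifs
      exacts [hμ s, le_rfl]
    have hzero := (sum_jointMass μ o).trans ho
    rw [ho, zero_mul]
    exact (Finset.sum_eq_zero_iff_of_nonneg fun j _ => hnonneg j).1 hzero j (Finset.mem_univ j)
  · exact (mul_div_cancel₀ _ ho).symm

theorem historyMass_mem_stdSimplex (hμ : μ ∈ stdSimplex ℝ (Traj B D t)) :
    historyMass μ ∈ stdSimplex ℝ (Fin (t + 1) → Obs B D) := by
  refine ⟨fun o => Finset.sum_nonneg fun s _ => ?_, ?_⟩
  · split_ifs
    exacts [hμ.1 s, le_rfl]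
  · simp only [historyMass]
    rw [Finset.sum_comm]
    simpa using hμ.2

theorem jointMass_of_traj_zero (μ : Traj B D 0 → ℝ) (o : Fin 1 → Obs B D) (j : Fin (B + 1)) :
    jointMass μ o j = μ fun _ => (j, o 0) := by
  have hobs (s : State B D) : (observe (t := 0) fun _ => s) = o ∧ s.1 = j ↔ s = (j, o 0) := by
    simp [observe, funext_iff, Fin.forall_fin_one, Prod.ext_iff, and_comm]
  refine ((Equiv.funUnique (Fin 1) (State B D)).symm.sum_comp _).symm.trans ?_
  change ∑ s : State B D,
    (if (observe (t := 0) fun _ => s) = o ∧ s.1 = j then μ fun _ => s else 0) = μ fun _ => (j, o 0)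
  simp only [hobs, Finset.sum_ite_eq', Finset.mem_univ, if_true]

end History

section Snoc

variable {t : ℕ}

theorem sum_snoc {α M : Type*} [Fintype α] [AddCommMonoid M] {n : ℕ}
    (φ : (Fin (n + 1) → α) → M) :
    ∑ f, φ f = ∑ f : Fin n → α, ∑ a : α, φ (Fin.snoc (α := fun _ => α) f a) := by
  rw [← (Fin.snocEquiv fun _ : Fin (n + 1) => α).sum_comp φ, Fintype.sum_prod_type,
    Finset.sum_comm]
  rfl

theorem observe_snoc (s : Traj B D t) (s' : State B D) :
    observe (t := t + 1) (Fin.snoc (α := fun _ => State B D) s s') =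
      Fin.snoc (α := fun _ => Obs B D) (observe s) s'.2 := by
  funext i
  induction i using Fin.lastCases <;> simp [observe]

variable (p lam : ℝ) (z₀ : BeliefState B D) (g : Policy B D)

theorem trajProb_snoc (s : Traj B D t) (s' : State B D) :
    trajProb p lam z₀ g (t + 1) (Fin.snoc (α := fun _ => State B D) s s') =
      trajProb p lam z₀ g t s * transProb p lam (s (Fin.last t)) (g t (observe s)) s' := by
  simp only [trajProb, Fin.init_snoc, Fin.snoc_last]

theorem jointMass_snoc (o : Fin (t + 1) → Obs B D) (o' : Obs B D) :
    jointMass (trajProb p lam z₀ g (t + 1)) (Fin.snoc (α := fun _ => Obs B D) o o') =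
      filterStep p lam (jointMass (trajProb p lam z₀ g t) o, o (Fin.last t)) (g t o) o' := by
  funext j
  have hstep (s : Traj B D t) (s' : State B D) :
      (observe s = o ∧ s'.2 = o') ∧ s'.1 = j ↔ s' = (j, o') ∧ observe s = o :=
    ⟨fun h => ⟨Prod.ext h.2 h.1.2, h.1.1⟩, fun h => h.1 ▸ ⟨⟨h.2, rfl⟩, rfl⟩⟩
  simp only [jointMass, filterStep, Finset.sum_mul]
  rw [sum_snoc, Finset.sum_comm (γ := Fin (B + 1))]
  refine Finset.sum_congr rfl fun s _ => ?_
  simp only [observe_snoc, Fin.snoc_inj, Fin.snoc_last, trajProb_snoc, hstep, ite_and,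
    Finset.sum_ite_eq', Finset.mem_univ, if_true]
  split_ifs with ho
  · subst ho
    simp only [ite_mul, zero_mul, Finset.sum_ite_eq, Finset.mem_univ, if_true]
    rfl
  · simp

end Snoc

section Posterior

variable {p lam : ℝ} {z₀ : BeliefState B D} (g : Policy B D) {t : ℕ}

theorem trajProb_mem_stdSimplex [NeZero B] (hp : p ∈ unitInterval) (hlam : lam ∈ unitInterval)
    (hz : z₀.1 ∈ stdSimplex ℝ (Fin (B + 1))) (t : ℕ) :
    trajProb p lam z₀ g t ∈ stdSimplex ℝ (Traj B D t) := by
  induction t with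
  | zero =>
    refine ⟨fun s => ?_, ?_⟩
    · rw [trajProb, initProb]
      split_ifs
      exacts [hz.1 _, le_rfl]
    · rw [← (Equiv.funUnique (Fin 1) (State B D)).symm.sum_comp, Fintype.sum_prod_type]
      simpa [trajProb, initProb] using hz.2
  | succ t ih =>
    refine ⟨fun s => mul_nonneg (ih.1 _) (transProb_nonneg hp hlam _ _ _), ?_⟩
    have hnext (s : State B D) (a : Action) : ∑ s', transProb p lam s a s' = 1 := by
      simpa [requestMean_const] using sum_transProb_mul_request (p := p) hlam s a fun _ => 1
    rw [sum_snoc]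
    simp only [trajProb_snoc, ← Finset.mul_sum, hnext, mul_one, ih.2]

theorem filterStep_smul (c : ℝ) (β : Belief B) (o o' : Obs B D) (a : Action) :
    filterStep p lam (c • β, o) a o' = c • filterStep p lam (β, o) a o' := by
  funext j
  simp only [filterStep, Pi.smul_apply, smul_eq_mul, Finset.mul_sum, mul_assoc]

variable {g} {o : Fin (t + 1) → Obs B D}

theorem jointMass_snoc_eq_smul (hμ : 0 ≤ trajProb p lam z₀ g t) (o' : Obs B D) :
    jointMass (trajProb p lam z₀ g (t + 1)) (Fin.snoc (α := fun _ => Obs B D) o o') =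
      historyMass (trajProb p lam z₀ g t) o •
        filterStep p lam (historyState (trajProb p lam z₀ g t) o) (g t o) o' := by
  rw [jointMass_snoc, jointMass_eq_smul_posterior o hμ, filterStep_smul]
  rfl

theorem historyMass_snoc (hμ : 0 ≤ trajProb p lam z₀ g t) (o' : Obs B D) :
    historyMass (trajProb p lam z₀ g (t + 1)) (Fin.snoc (α := fun _ => Obs B D) o o') =
      historyMass (trajProb p lam z₀ g t) o *
        obsProb p lam (historyState (trajProb p lam z₀ g t) o) (g t o) o' := by
  rw [← sum_jointMass, jointMass_snoc_eq_smul hμ, obsProb_eq_sum_filterStep, Finset.mul_sum]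
  rfl

theorem historyState_snoc (hμ : 0 ≤ trajProb p lam z₀ g t) (o' : Obs B D)
    (ho : historyMass (trajProb p lam z₀ g t) o ≠ 0) :
    historyState (trajProb p lam z₀ g (t + 1)) (Fin.snoc (α := fun _ => Obs B D) o o') =
      (bayesUpdate p lam (historyState (trajProb p lam z₀ g t) o) (g t o) o', o') := by
  refine Prod.ext (funext fun j => ?_) (Fin.snoc_last (α := fun _ => Obs B D) o' o)
  simp only [historyState]
  rw [posterior_apply, jointMass_snoc_eq_smul hμ, historyMass_snoc hμ]
  exact mul_div_mul_left _ _ ho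

theorem historyState_zero (hz : z₀.1 ∈ stdSimplex ℝ (Fin (B + 1))) {o : Fin 1 → Obs B D}
    (ho : historyMass (trajProb p lam z₀ g 0) o ≠ 0) :
    historyState (trajProb p lam z₀ g 0) o = z₀ := by
  have hjoint : jointMass (trajProb p lam z₀ g 0) o = fun j => initProb z₀ (j, o 0) :=
    funext fun j => jointMass_of_traj_zero _ _ j
  rw [← sum_jointMass, hjoint] at ho
  have hobs : o 0 = z₀.2 := by_contra fun h => ho (by simp [initProb, h])
  refine Prod.ext (funext fun j => ?_) hobs
  simp only [historyState]
  rw [posterior_apply, ← sum_jointMass, hjoint]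
  simp [initProb, hobs, hz.2]

end Posterior

section Potential

variable {p lam : ℝ} {z₀ : BeliefState B D} (g : Policy B D)

/-- The expectation of `Φ` at the belief-state in the `(t+1)`-st slot. -/
def expectedPotential (p lam : ℝ) (z₀ : BeliefState B D) (g : Policy B D)
    (Φ : BeliefState B D → ℝ) (t : ℕ) : ℝ :=
  historyMass (trajProb p lam z₀ g t) ⬝ᵥ fun o => Φ (historyState (trajProb p lam z₀ g t) o)

theorem expectedPotential_succ {t : ℕ} (hμ : 0 ≤ trajProb p lam z₀ g t)
    (Φ : BeliefState B D → ℝ) :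
    expectedPotential p lam z₀ g Φ (t + 1) =
      historyMass (trajProb p lam z₀ g t) ⬝ᵥ fun o =>
        ∑ o', obsProb p lam (historyState (trajProb p lam z₀ g t) o) (g t o) o' *
          Φ (bayesUpdate p lam (historyState (trajProb p lam z₀ g t) o) (g t o) o', o') := by
  rw [expectedPotential, dotProduct, sum_snoc]
  refine Finset.sum_congr rfl fun o _ => ?_
  rw [Finset.mul_sum]
  refine Finset.sum_congr rfl fun o' _ => ?_
  rw [historyMass_snoc hμ]
  rcases eq_or_ne (historyMass (trajProb p lam z₀ g t) o) 0 with ho | ho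
  · simp only [ho, zero_mul]
  · rw [historyState_snoc hμ o' ho, mul_assoc]

theorem expectedCost_eq {t : ℕ} (hμ : 0 ≤ trajProb p lam z₀ g t) :
    expectedCost p lam z₀ g t =
      historyMass (trajProb p lam z₀ g t) ⬝ᵥ fun o =>
        (historyState (trajProb p lam z₀ g t) o).1 ⬝ᵥ
          fun b => cost (b, o (Fin.last t)) (g t o) := by
  refine (sum_mul_eq_sum_jointMass _ fun o b => cost (b, o (Fin.last t)) (g t o)).trans ?_
  refine Finset.sum_congr rfl fun o _ => ?_
  rw [jointMass_eq_smul_posterior o hμ, smul_dotProduct, smul_eq_mul]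
  rfl

theorem expectedCost_add_expectedPotential {t : ℕ} (hμ : 0 ≤ trajProb p lam z₀ g t)
    (Φ : BeliefState B D → ℝ) :
    expectedCost p lam z₀ g t + expectedPotential p lam z₀ g Φ (t + 1) =
      historyMass (trajProb p lam z₀ g t) ⬝ᵥ fun o =>
        actionValue p lam Φ (historyState (trajProb p lam z₀ g t) o) (g t o) := by
  rw [expectedCost_eq g hμ, expectedPotential_succ g hμ, ← dotProduct_add]
  rfl

end Potential

section Verification

variable [NeZero B] {p lam : ℝ} {S : Set (Belief B)} {z₀ : BeliefState B D} (g : Policy B D)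

theorem historyState_mem (hp : p ∈ unitInterval) (hlam : lam ∈ unitInterval)
    (hS : BayesInvariant D p lam S) (hz : z₀.1 ∈ S) {t : ℕ} {o : Fin (t + 1) → Obs B D}
    (ho : historyMass (trajProb p lam z₀ g t) o ≠ 0) :
    (historyState (trajProb p lam z₀ g t) o).1 ∈ S := by
  have hz' := hS.subset_stdSimplex hz
  induction t with
  | zero => rwa [historyState_zero hz' ho]
  | succ t ih =>
    have hμ := (trajProb_mem_stdSimplex g hp hlam hz' t).1
    rw [← Fin.snoc_init_self (α := fun _ => Obs B D) o] at ho ⊢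
    rw [historyMass_snoc hμ] at ho
    have hinit := left_ne_zero_of_mul ho
    rw [historyState_snoc hμ _ hinit]
    exact hS.bayesUpdate_mem (ih hinit) (right_ne_zero_of_mul ho)

theorem expectedCost_le (hp : p ∈ unitInterval) (hlam : lam ∈ unitInterval)
    (hz : z₀.1 ∈ stdSimplex ℝ (Fin (B + 1))) (t : ℕ) : expectedCost p lam z₀ g t ≤ D :=
  dotProduct_le_of_mem_stdSimplex (trajProb_mem_stdSimplex g hp hlam hz t) fun s => by
    rw [cost_eq]
    exact (request_mul_age_le _ _).trans (request_mul_le _)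

section Invariant

variable (hp : p ∈ unitInterval) (hlam : lam ∈ unitInterval) (hS : BayesInvariant D p lam S)
  (hz : z₀.1 ∈ S) {Φ : BeliefState B D → ℝ} {C K : ℝ}

include hp hlam hS hz

theorem historyMass_dotProduct_le {t : ℕ} {f f' : (Fin (t + 1) → Obs B D) → ℝ}
    (h : ∀ o, (historyState (trajProb p lam z₀ g t) o).1 ∈ S → f o ≤ f' o) :
    historyMass (trajProb p lam z₀ g t) ⬝ᵥ f ≤ historyMass (trajProb p lam z₀ g t) ⬝ᵥ f' := by
  have hμ := trajProb_mem_stdSimplex g hp hlam (hS.subset_stdSimplex hz) t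
  exact dotProduct_le_dotProduct_of_ne_zero (historyMass_mem_stdSimplex hμ).1
    fun o ho => h o (historyState_mem g hp hlam hS hz ho)

theorem historyMass_dotProduct_const (t : ℕ) (c : ℝ) :
    (historyMass (trajProb p lam z₀ g t) ⬝ᵥ fun _ => c) = c :=
  dotProduct_const_of_mem_stdSimplex (historyMass_mem_stdSimplex
    (trajProb_mem_stdSimplex g hp hlam (hS.subset_stdSimplex hz) t)) c

theorem abs_expectedPotential_le (hK : ∀ z : BeliefState B D, z.1 ∈ S → |Φ z| ≤ K) (t : ℕ) :
    |expectedPotential p lam z₀ g Φ t| ≤ K := by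
  have hconst := historyMass_dotProduct_const g hp hlam hS hz t
  refine abs_le.2 ⟨(hconst (-K)).symm.trans_le ?_, le_of_le_of_eq ?_ (hconst K)⟩
  · exact historyMass_dotProduct_le g hp hlam hS hz fun o ho => (abs_le.1 (hK _ ho)).1
  · exact historyMass_dotProduct_le g hp hlam hS hz fun o ho => (abs_le.1 (hK _ ho)).2

theorem historyMass_dotProduct_const_add (t : ℕ) :
    (historyMass (trajProb p lam z₀ g t) ⬝ᵥ fun o =>
      C + Φ (historyState (trajProb p lam z₀ g t) o)) = C + expectedPotential p lam z₀ g Φ t :=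
  (dotProduct_add _ (fun _ => C) _).trans
    (congrArg (· + _) (historyMass_dotProduct_const g hp hlam hS hz t C))

theorem le_expectedCost
    (hΦ : ∀ z : BeliefState B D, z.1 ∈ S → ∀ a, C + Φ z ≤ actionValue p lam Φ z a) (t : ℕ) :
    C + expectedPotential p lam z₀ g Φ t - expectedPotential p lam z₀ g Φ (t + 1) ≤
      expectedCost p lam z₀ g t := by
  have hμ := trajProb_mem_stdSimplex g hp hlam (hS.subset_stdSimplex hz) t
  rw [sub_le_iff_le_add, expectedCost_add_expectedPotential g hμ.1,
    ← historyMass_dotProduct_const_add g hp hlam hS hz]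
  exact historyMass_dotProduct_le g hp hlam hS hz fun o ho => hΦ _ ho _

theorem expectedCost_beliefPolicy_le {π : BeliefState B D → Action}
    (hπ : ∀ z : BeliefState B D, z.1 ∈ S → actionValue p lam Φ z (π z) ≤ C + Φ z) (t : ℕ) :
    expectedCost p lam z₀ (beliefPolicy p lam z₀ π) t ≤
      C + expectedPotential p lam z₀ (beliefPolicy p lam z₀ π) Φ t -
        expectedPotential p lam z₀ (beliefPolicy p lam z₀ π) Φ (t + 1) := by
  set g := beliefPolicy p lam z₀ π with hg
  have hμ := trajProb_mem_stdSimplex g hp hlam (hS.subset_stdSimplex hz) t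
  have hact (o : Fin (t + 1) → Obs B D) : g t o = π (historyState (trajProb p lam z₀ g t) o) := by
    rw [hg, trajProb_beliefPolicy]
    rfl
  rw [le_sub_iff_add_le, expectedCost_add_expectedPotential g hμ.1,
    ← historyMass_dotProduct_const_add g hp hlam hS hz]
  exact historyMass_dotProduct_le g hp hlam hS hz fun o ho => hact o ▸ hπ _ ho

theorem isOptimalFrom_of_actionValue {π : BeliefState B D → Action} (hb : BoundedOn S Φ)
    (hΦ : ∀ z : BeliefState B D, z.1 ∈ S → ∀ a, C + Φ z ≤ actionValue p lam Φ z a)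
    (hπ : ∀ z : BeliefState B D, z.1 ∈ S → actionValue p lam Φ z (π z) ≤ C + Φ z) :
    IsOptimalFrom p lam z₀ π C := by
  obtain ⟨K, hK⟩ := hb
  exact ⟨tendsto_average_of_telescope (abs_expectedPotential_le _ hp hlam hS hz hK) fun t =>
      le_antisymm (expectedCost_beliefPolicy_le hp hlam hS hz hπ t)
        (le_expectedCost _ hp hlam hS hz hΦ t),
    fun g => le_liminf_average_of_telescope (abs_expectedPotential_le g hp hlam hS hz hK)
      (le_expectedCost g hp hlam hS hz hΦ) (expectedCost_le g hp hlam (hS.subset_stdSimplex hz))⟩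

end Invariant

theorem SolvesBellman.isOptimalFrom (hD : 2 ≤ D) (hp : p ∈ unitInterval)
    (hlam : lam ∈ unitInterval) (hS : IsBeliefSpace lam S) {C : ℝ} {h : BeliefState B D → ℝ}
    (hh : SolvesBellman p lam S C h) (hb : BoundedOn S h) {π : BeliefState B D → Action}
    (hπ : ∀ z : BeliefState B D, z.1 ∈ S → ∀ a, Q p lam h z (π z) ≤ Q p lam h z a)
    (hz : z₀.1 ∈ S) : IsOptimalFrom p lam z₀ π C := by
  refine isOptimalFrom_of_actionValue hp hlam (hS.bayesInvariant hD hlam) hz hb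
    (fun z hz a => ?_) fun z hz => ?_
  · rw [actionValue_eq_Q hD hlam h (hS.1 hz), hh z hz]
    match a with
    | 0 => exact min_le_left _ _
    | 1 => exact min_le_right _ _
  · rw [actionValue_eq_Q hD hlam h (hS.1 hz), hh z hz]
    exact le_min (hπ z hz 0) (hπ z hz 1)

theorem isOptimalFrom_request {z₀ : BeliefState B 1} (hp : p ∈ unitInterval)
    (hlam : lam ∈ unitInterval) (π : BeliefState B 1 → Action)
    (hz : z₀.1 ∈ stdSimplex ℝ (Fin (B + 1))) :
    IsOptimalFrom p lam z₀ π p :=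
  isOptimalFrom_of_actionValue hp hlam (bayesInvariant_stdSimplex hp hlam) hz
    (boundedOn_request _) (fun _ hz a => (actionValue_request hlam hz a).ge)
    fun _ hz => (actionValue_request hlam hz _).le

end Verification

end

end AoI

theorem theorem1 (B D : ℕ) (hB : 1 ≤ B) (hD : 1 ≤ D) (p lam : ℝ)
    (hp : p ∈ Set.Icc (0 : ℝ) 1) (hlam : lam ∈ Set.Icc (0 : ℝ) 1) :
    -- for `D ≥ 2`, the explicit `Q` is the action-value function of the belief-state MDP
    (2 ≤ D → ∀ (h : AoI.BeliefState B D → ℝ) (z : AoI.BeliefState B D) (a : AoI.Action),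
      z.1 ∈ stdSimplex ℝ (Fin (B + 1)) → AoI.actionValue p lam h z a = AoI.Q p lam h z a) ∧
    -- one constant serves all belief spaces and all initial belief-states
    ∃ Cstar : ℝ, ∀ S : Set (AoI.Belief B), AoI.IsBeliefSpace lam S →
      (∃ h : AoI.BeliefState B D → ℝ, AoI.BoundedOn S h ∧ AoI.SolvesBellman p lam S Cstar h) ∧
      ∀ (C : ℝ) (h : AoI.BeliefState B D → ℝ),
        AoI.BoundedOn S h → AoI.SolvesBellman p lam S C h →
        C = Cstar ∧
        ∀ π : AoI.BeliefState B D → AoI.Action,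
          (∀ z : AoI.BeliefState B D, z.1 ∈ S →
            ∀ a : AoI.Action, AoI.Q p lam h z (π z) ≤ AoI.Q p lam h z a) →
          ∀ z₀ : AoI.BeliefState B D, z₀.1 ∈ S → AoI.IsOptimalFrom p lam z₀ π Cstar := by
  have : NeZero B := ⟨by omega⟩
  have : NeZero D := ⟨by omega⟩
  refine ⟨fun h2 h z a hz => AoI.actionValue_eq_Q h2 hlam h hz a, ?_⟩
  obtain ⟨C₀, h₀, ⟨K, hK⟩, hsol⟩ := AoI.exists_solvesBellman (B := B) (D := D) hp hlam
  refine ⟨C₀, fun S hS => ?_⟩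
  have hb₀ : AoI.BoundedOn S h₀ := ⟨K, fun z hz => hK z (hS.1 hz)⟩
  have hsol₀ : AoI.SolvesBellman p lam S C₀ h₀ := fun z hz => hsol z (hS.1 hz)
  refine ⟨⟨h₀, hb₀, hsol₀⟩, fun C h hb hh => ?_⟩
  obtain rfl : C = C₀ := hh.const_unique hsol₀ hp hS hb hb₀
  refine ⟨rfl, fun π hπ z₀ hz => ?_⟩
  rcases hD.eq_or_lt with rfl | h2
  · obtain rfl : p = C :=
      (AoI.solvesBellman_request hS.1).const_unique hh hp hS (AoI.boundedOn_request S) hb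
    exact AoI.isOptimalFrom_request hp hlam π (hS.1 hz)
  · exact hh.isOptimalFrom h2 hp hlam hS hb hπ hz
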